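/- Let $(M,g)$ be a Riemannian manifold of dimension $n\ge 2$, let $B\subset\mathbb R^2$ be open with coordinates $(\rho,s)$, let $g_B$ be a Lorentzian metric on $B$ admitting two lightlike vector fields $\xi,\eta\in\mathfrak X(B)$ with $g_B(\xi,\eta)=-1$, and let $\varphi\in C^\infty(B)$, $\varphi>0$. Equip $\widetilde M=B\times M$ with the Lorentzian warped metric $\widetilde g=\pi_B^*(g_B)+(\varphi\circ\pi_B)^2\,\pi_M^*(g)$ and let $\widetilde\nabla$ be its Levi-Civita connection. Let $(\rho_0,s_0)\in B$ satisfy $\varphi(\rho_0,s_0)=1$ and $\xi_{(\rho_0,s_0)}\varphi\neq 0$, and consider the spacelike immersion $\Psi\colon M\to\widetilde M$, $\Psi(x)=(\rho_0,s_0,x)$, which satisfies $\Psi^*\widetilde g=g$. Let $\mathcal T=\Psi^*(T\widetilde M)$ with the bundle metric $\widetilde g$, the line subbundle $\mathcal T^1=\mathrm{Span}(\xi)$ ($\xi$ lifted to $\widetilde M$ and restricted to $\Psi$), and the connection induced by $\widetilde\nabla$, again denoted $\widetilde\nabla$. Definitions. A tractor conformal bundle on $M$ is a vector bundle of rank $n+2$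 with a bundle metric $h$ of signature $(n+1,1)$ and a lightlike line subbundle $\mathcal T^1$. A tractor connection on it is a linear connection $\nabla$ with $\nabla h=0$ such that $\beta\colon TM\to\mathrm{Hom}(\mathcal T^1,(\mathcal T^1)^\perp/\mathcal T^1)$, $\beta(X)(\sigma)=\nabla_X\sigma+\mathcal T^1$, is an isomorphism of vector bundles; write $\beta_\sigma(X)=\nabla_X\sigma+\mathcal T^1$ and $h^\sigma(X,Y)=h(\beta_\sigma(X),\beta_\sigma(Y))$ for sections $\sigma$ of $\mathcal T^1$. It is standard for $g$ if the metrics $h^\sigma$, $\sigma$ nonvanishing, lie in the conformal class of $g$. It is normal if its curvature $R$ satisfies $R(X,Y)\sigma\in\Gamma(\mathcal T^1)$ for all $X,Y\in\mathfrak X(M)$, $\sigma\in\Gamma(\mathcal T^1)$, and $\sum_{i=1}^n h\big(R(E_i,X)\beta_\sigma(Y),\beta_\sigma(E_i)\big)=0$ for all $X,Y$ and all $h^\sigma$-orthonormal frames $(E_1,\dots,E_n)$. Then: (1) $(\mathcal T,\mathcal T^1,\widetilde g,\widetilde\nabla)$ is always a standard tractor conformal bundle with tractor connection for $g$. (2)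 The tractor connection $\widetilde\nabla$ is normal if and only if $(M,g)$ is an Einstein manifold, $\mathrm{Ric}=\Lambda\,g$, with constant $\Lambda=(n-1)\|\mathbf H\|^2=(n-1)\|\nabla\varphi(\rho_0,s_0)\|^2$, where $\mathbf H$ is the mean curvature vector field of $\Psi$, $\nabla\varphi$ is the gradient of $\varphi$ in $(B,g_B)$, and $\|v\|^2$ denotes the (possibly negative) square $\widetilde g(v,v)$, respectively $g_B(v,v)$. -/

import Mathlib

open Bundle Manifold
open scoped ContDiff

noncomputable section

/-! ### Pulled back bundles: the fibres are topological vector spaces -/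

section PullbackInstances

variable {N M : Type*} (f : M → N) (V : N → Type*) (x : M)

instance pullbackAddCommGroup [∀ y, AddCommGroup (V y)] : AddCommGroup ((f *ᵖ V) x) :=
  inferInstanceAs (AddCommGroup (V (f x)))

instance pullbackIsTopologicalAddGroup [∀ y, AddCommGroup (V y)] [∀ y, TopologicalSpace (V y)]
    [∀ y, IsTopologicalAddGroup (V y)] : IsTopologicalAddGroup ((f *ᵖ V) x) :=
  inferInstanceAs (IsTopologicalAddGroup (V (f x)))

instance pullbackContinuousSMul [∀ y, AddCommGroup (V y)] [∀ y, TopologicalSpace (V y)]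
    [∀ y, Module ℝ (V y)] [∀ y, ContinuousSMul ℝ (V y)] : ContinuousSMul ℝ ((f *ᵖ V) x) :=
  inferInstanceAs (ContinuousSMul ℝ (V (f x)))

end PullbackInstances

/-! ### Sections and linear connections -/

section Connections

variable {E : Type*} [NormedAddCommGroup E] [NormedSpace ℝ E]
  {H : Type*} [TopologicalSpace H] {I : ModelWithCorners ℝ E H}
  {M : Type*} [TopologicalSpace M] [ChartedSpace H M]
  {F : Type*} [NormedAddCommGroup F] [NormedSpace ℝ F]
  {V : M → Type*} [TopologicalSpace (TotalSpace F V)]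
  [∀ x, AddCommGroup (V x)] [∀ x, Module ℝ (V x)] [∀ x, TopologicalSpace (V x)]
  [FiberBundle F V] [VectorBundle ℝ F V]

variable (F) in
theorem trivialization_add {σ σ' : Π x, V x} (x : M) :
    (fun y ↦ (trivializationAt F V x ⟨y, (σ + σ') y⟩).2) =ᶠ[nhds x]
      (fun y ↦ (trivializationAt F V x ⟨y, σ y⟩).2)
        + (fun y ↦ (trivializationAt F V x ⟨y, σ' y⟩).2) := by
  filter_upwards [(trivializationAt F V x).open_baseSet.mem_nhds
    (FiberBundle.mem_baseSet_trivializationAt' x)] with y hy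
  exact ((trivializationAt F V x).linear ℝ hy).map_add (σ y) (σ' y)

variable (F) in
theorem trivialization_smul {σ : Π x, V x} {f : M → ℝ} (x : M) :
    (fun y ↦ (trivializationAt F V x ⟨y, (f • σ) y⟩).2) =ᶠ[nhds x]
      f • (fun y ↦ (trivializationAt F V x ⟨y, σ y⟩).2) := by
  filter_upwards [(trivializationAt F V x).open_baseSet.mem_nhds
    (FiberBundle.mem_baseSet_trivializationAt' x)] with y hy
  exact ((trivializationAt F V x).linear ℝ hy).map_smul (f y) (σ y)

theorem mvfderiv_congr {f g : M → F} {x : M} (h : f =ᶠ[nhds x] g) :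
    mvfderiv I f x = mvfderiv I g x := by
  simp only [mvfderiv]
  rw [h.mfderiv_eq]
  rfl

variable (I F) in
/-- `σ` is a smooth (`C^∞`) global section of the bundle `V` with model fibre `F`. -/
def IsSmoothSection (σ : Π x, V x) : Prop :=
  ContMDiff I (I.prod 𝓘(ℝ, F)) ∞ (fun x ↦ TotalSpace.mk' F x (σ x))

variable (I) in
/-- `X` is a smooth vector field on `M`. -/
def IsSmoothField [IsManifold I 1 M] (X : Π x : M, TangentSpace I x) : Prop :=
  IsSmoothSection I E X

variable (I F) in
/-- The derivative at `x` of the components of the section `σ` in the preferred local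
trivialization of `V` at `x`. -/
def trivDeriv (σ : Π x, V x) (x : M) : TangentSpace I x →L[ℝ] V x :=
  (trivializationAt F V x).symmL ℝ x ∘L
    mvfderiv I (fun y ↦ (trivializationAt F V x ⟨y, σ y⟩).2) x

variable [∀ x, IsTopologicalAddGroup (V x)] [∀ x, ContinuousSMul ℝ (V x)]

/-- The linear connection `∇ σ = dσ + Γ(σ)`, where at every point `x` the differential `dσ` and
the connection form `Γ x` are those of the preferred local trivialization at `x`. -/
def connectionOfForm (Γ : Π x : M, V x →ₗ[ℝ] (TangentSpace I x →L[ℝ] V x)) :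
    CovariantDerivative I F V where
  toFun σ x := trivDeriv I F σ x + Γ x (σ x)
  isCovariantDerivativeOnUniv :=
    { add := by
        intro σ σ' x hσ hσ' _
        rw [mdifferentiableAt_section] at hσ hσ'
        simp only [trivDeriv]
        rw [mvfderiv_congr (trivialization_add F x), mvfderiv_add hσ hσ']
        ext v
        simp
        abel
      leibniz := by
        intro σ f x hσ hf _
        rw [mdifferentiableAt_section] at hσ
        simp only [trivDeriv]
        rw [mvfderiv_congr (trivialization_smul F x), mvfderiv_smul hf hσ]
        ext v
        have h : (trivializationAt F V x).symmL ℝ x (trivializationAt F V x ⟨x, σ x⟩).2 = σ x := by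
          rw [(trivializationAt F V x).symmL_apply (FiberBundle.mem_baseSet_trivializationAt' x)]
          simp [FiberBundle.mem_baseSet_trivializationAt' x]
        simp [h, smul_add]
        abel }

/-- The curvature `R(X,Y)σ = ∇_X ∇_Y σ - ∇_Y ∇_X σ - ∇_{[X,Y]} σ` of a linear connection. -/
def curvature (cov : CovariantDerivative I F V) (X Y : Π x : M, TangentSpace I x)
    (σ : Π x, V x) (x : M) : V x :=
  cov (fun y ↦ cov σ y (Y y)) x (X x) - cov (fun y ↦ cov σ y (X y)) x (Y x)
    - cov σ x (VectorField.mlieBracket I X Y x)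

end Connections

section PullbackConnection

variable {E : Type*} [NormedAddCommGroup E] [NormedSpace ℝ E]
  {H : Type*} [TopologicalSpace H] {I : ModelWithCorners ℝ E H}
  {M : Type*} [TopologicalSpace M] [ChartedSpace H M]
  {E' : Type*} [NormedAddCommGroup E'] [NormedSpace ℝ E']
  {H' : Type*} [TopologicalSpace H'] {J : ModelWithCorners ℝ E' H'}
  {N : Type*} [TopologicalSpace N] [ChartedSpace H' N]
  {F : Type*} [NormedAddCommGroup F] [NormedSpace ℝ F]
  {V : N → Type*} [TopologicalSpace (TotalSpace F V)]
  [∀ x, AddCommGroup (V x)] [∀ x, Module ℝ (V x)] [∀ x, TopologicalSpace (V x)]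
  [FiberBundle F V] [VectorBundle ℝ F V]

theorem extend_add_smul {x : N} (a b : ℝ) (s t : V x) :
    ∀ᶠ y in nhds x, FiberBundle.extend F (a • s + b • t) y =
      (a • FiberBundle.extend F s + b • FiberBundle.extend F t) y := by
  filter_upwards [(trivializationAt F V x).open_baseSet.mem_nhds
    (FiberBundle.mem_baseSet_trivializationAt' x)] with y hy
  have h (w : V x) : FiberBundle.extend F w y = (trivializationAt F V x).symmₗ ℝ y
      ((trivializationAt F V x).linearMapAt ℝ x w) := by
    rw [(trivializationAt F V x).coe_linearMapAt_of_mem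
      (FiberBundle.mem_baseSet_trivializationAt' x)]
    simp [FiberBundle.extend, hy]
  rw [Pi.add_apply, Pi.smul_apply, Pi.smul_apply, h, h, h, map_add, map_add, map_smul, map_smul,
    map_smul, map_smul]

variable [∀ x, IsTopologicalAddGroup (V x)] [∀ x, ContinuousSMul ℝ (V x)]
  [IsManifold J 1 N] [ContMDiffVectorBundle 1 F V J]

/-- The connection form of `∇` at `x` in the preferred local trivialization of `V` at `x`: the
vector `s` in the fibre over `x` is extended to the section with constant components in that
trivialization, which is then differentiated at `x`. -/
def connectionForm (cov : CovariantDerivative J F V) (x : N) :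
    V x →ₗ[ℝ] (TangentSpace J x →L[ℝ] V x) where
  toFun s := cov (FiberBundle.extend F s) x
  map_add' s t := by
    have h := extend_add_smul (F := F) 1 1 s t
    simp only [one_smul] at h
    rw [cov.isCovariantDerivativeOnUniv.congr_of_eventuallyEq
      (FiberBundle.mdifferentiableAt_extend ..)
      (mdifferentiableAt_add_section (FiberBundle.mdifferentiableAt_extend ..)
        (FiberBundle.mdifferentiableAt_extend ..)) Filter.univ_mem h,
      cov.isCovariantDerivativeOnUniv.add (FiberBundle.mdifferentiableAt_extend ..)
      (FiberBundle.mdifferentiableAt_extend ..)]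
  map_smul' c s := by
    have h := extend_add_smul (F := F) c 0 s 0
    simp only [zero_smul, add_zero] at h
    rw [cov.isCovariantDerivativeOnUniv.congr_of_eventuallyEq
      (FiberBundle.mdifferentiableAt_extend ..)
      (MDifferentiableAt.smul_const_section (FiberBundle.mdifferentiableAt_extend ..))
      Filter.univ_mem h,
      cov.isCovariantDerivativeOnUniv.smul_const _ (FiberBundle.mdifferentiableAt_extend ..)]
    rfl

/-- The connection form at `x` of the pulled back connection: the pullback by `f` of the connection
form at `f x`. -/
def pullbackConnectionForm (cov : CovariantDerivative J F V) (f : C^∞⟮I, M; J, N⟯) (x : M) :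
    (f *ᵖ V) x →ₗ[ℝ] (TangentSpace I x →L[ℝ] (f *ᵖ V) x) where
  toFun s := (connectionForm cov (f x) s ∘L mfderiv I J f x : TangentSpace I x →L[ℝ] V (f x))
  map_add' s t :=
    (congrArg (· ∘L mfderiv I J f x) ((connectionForm cov (f x)).map_add s t)).trans
      (ContinuousLinearMap.add_comp ..)
  map_smul' c s :=
    (congrArg (· ∘L mfderiv I J f x) ((connectionForm cov (f x)).map_smul c s)).trans
      (ContinuousLinearMap.smul_comp ..)

/-- The pullback `f^*∇` of a linear connection on `V → N` along `f : M → N`: the linear connection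
on `f^*V → M` with `(f^*∇)_v (σ ∘ f) = ∇_{df(v)} σ`. -/
def pullbackConnection (cov : CovariantDerivative J F V) (f : C^∞⟮I, M; J, N⟯) :
    CovariantDerivative I F (f *ᵖ V) :=
  connectionOfForm (pullbackConnectionForm cov f)

end PullbackConnection

/-! ### Pseudo-Riemannian metrics and their Levi-Civita connections -/

/-- A symmetric bilinear form of Lorentzian signature `(dim - 1, 1)`: there is a timelike vector
whose orthogonal complement is spacelike. -/
structure IsLorentzForm {W : Type*} [AddCommGroup W] [Module ℝ W] [TopologicalSpace W]
    [IsTopologicalAddGroup W] [ContinuousSMul ℝ W] (b : W →L[ℝ] W →L[ℝ] ℝ) : Prop where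
  symm : ∀ v w, b v w = b w v
  signature : ∃ v, b v v < 0 ∧ ∀ w, w ≠ 0 → b v w = 0 → 0 < b w w

section LeviCivita

variable {E : Type*} [NormedAddCommGroup E] [NormedSpace ℝ E]
  {H : Type*} [TopologicalSpace H] {I : ModelWithCorners ℝ E H}
  {M : Type*} [TopologicalSpace M] [ChartedSpace H M] [IsManifold I 1 M]

variable (I M) in
/-- A smooth Lorentzian metric on `M`. -/
structure LorentzMetric where
  inner (x : M) : TangentSpace I x →L[ℝ] TangentSpace I x →L[ℝ] ℝ
  contMDiff : ContMDiff I (I.prod 𝓘(ℝ, E →L[ℝ] E →L[ℝ] ℝ)) ∞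
    (fun x ↦ TotalSpace.mk' (E →L[ℝ] E →L[ℝ] ℝ) (E := fun x : M ↦
      TangentSpace I x →L[ℝ] TangentSpace I x →L[ℝ] ℝ) x (inner x))
  lorentz (x : M) : IsLorentzForm (inner x)

/-- The matrix of the metric `g` at `y`, as a bilinear form on the model space, in the coordinate
frame of the preferred chart at `x`. -/
def metricCoord (g : Π x : M, TangentSpace I x →L[ℝ] TangentSpace I x →L[ℝ] ℝ) (x y : M) :
    E →L[ℝ] E →L[ℝ] ℝ :=
  ContinuousLinearMap.precomp ℝ ((trivializationAt E (TangentSpace I) x).symmL ℝ y) ∘L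
    g y ∘L (trivializationAt E (TangentSpace I) x).symmL ℝ y

/-- The derivative at `x` of the matrix of `g` in the preferred chart at `x`: the number
`metricCoordDeriv g x u v w` is `∂_u (g(v, w))`. -/
def metricCoordDeriv (g : Π x : M, TangentSpace I x →L[ℝ] TangentSpace I x →L[ℝ] ℝ) (x : M) :
    E →L[ℝ] E →L[ℝ] E →L[ℝ] ℝ :=
  mvfderiv I (metricCoord g x) x ∘L (trivializationAt E (TangentSpace I) x).symmL ℝ x

/-- The linear form `2 g(Γ(v, w), ·)` for the Christoffel symbols `Γ` of `g`: it takes `z` to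
`∂_v (g(w, z)) + ∂_w (g(v, z)) - ∂_z (g(v, w))`. -/
def koszulForm (g : Π x : M, TangentSpace I x →L[ℝ] TangentSpace I x →L[ℝ] ℝ) (x : M) (w : E) :
    E →L[ℝ] E →L[ℝ] ℝ :=
  (metricCoordDeriv g x).flip w + metricCoordDeriv g x w - ((metricCoordDeriv g x).flip w).flip

theorem koszulForm_apply (g : Π x : M, TangentSpace I x →L[ℝ] TangentSpace I x →L[ℝ] ℝ) (x : M)
    (w v z : E) : koszulForm g x w v z =
      metricCoordDeriv g x v w z + metricCoordDeriv g x w v z - metricCoordDeriv g x z w v :=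
  rfl

/-- The Christoffel symbols of `g` at `x` in the preferred chart at `x`: `christoffel g x w v` is
the vector `Γ(v, w)` with
`2 g(Γ(v, w), z) = ∂_v (g(w, z)) + ∂_w (g(v, z)) - ∂_z (g(v, w))` for all `z`. -/
def christoffel (g : Π x : M, TangentSpace I x →L[ℝ] TangentSpace I x →L[ℝ] ℝ) (x : M) :
    E →ₗ[ℝ] (E →L[ℝ] E) where
  toFun w := (1 / 2 : ℝ) • ((metricCoord g x x).inverse ∘L koszulForm g x w)
  map_add' v w := by
    have h : koszulForm g x (v + w) = koszulForm g x v + koszulForm g x w := by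
      ext a b
      simp only [koszulForm_apply, ContinuousLinearMap.map_add, _root_.add_apply]
      ring
    rw [h, ContinuousLinearMap.comp_add, smul_add]
  map_smul' c w := by
    have h : koszulForm g x (c • w) = c • koszulForm g x w := by
      ext a b
      simp only [koszulForm_apply, ContinuousLinearMap.map_smul, _root_.smul_apply, smul_eq_mul]
      ring
    rw [h, ContinuousLinearMap.comp_smul, smul_comm]
    rfl

/-- The connection form of the Levi-Civita connection in the preferred chart at `x`. -/
def leviCivitaForm (g : Π x : M, TangentSpace I x →L[ℝ] TangentSpace I x →L[ℝ] ℝ) (x : M) :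
    TangentSpace I x →ₗ[ℝ] (TangentSpace I x →L[ℝ] TangentSpace I x) where
  toFun s := (trivializationAt E (TangentSpace I) x).symmL ℝ x ∘L
    christoffel g x ((trivializationAt E (TangentSpace I) x).continuousLinearMapAt ℝ x s) ∘L
      (trivializationAt E (TangentSpace I) x).continuousLinearMapAt ℝ x
  map_add' s t := by
    ext v
    simp only [map_add, ContinuousLinearMap.comp_apply, _root_.add_apply]
  map_smul' c s := by
    ext v
    simp only [map_smul, ContinuousLinearMap.comp_apply, _root_.smul_apply,
      RingHom.id_apply]

/-- The Levi-Civita connection of a pseudo-Riemannian metric `g` (a smooth field of nondegenerate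
symmetric bilinear forms on the tangent spaces): in the preferred chart at `x`, it is
`∇_v X = dX(v) + Γ(v, X)` at `x`, with `Γ` the Christoffel symbols of `g`. -/
def leviCivita (g : Π x : M, TangentSpace I x →L[ℝ] TangentSpace I x →L[ℝ] ℝ) :
    CovariantDerivative I E (TangentSpace I : M → Type _) :=
  connectionOfForm (leviCivitaForm g)

/-- The gradient of `φ` with respect to the metric `g`: the vector `G` with `g(G, ·) = dφ`. -/
def metricGradient (g : Π x : M, TangentSpace I x →L[ℝ] TangentSpace I x →L[ℝ] ℝ) (φ : M → ℝ)
    (x : M) : TangentSpace I x :=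
  (g x).inverse (mvfderiv I φ x)

end LeviCivita

section Warped

variable {E : Type*} [NormedAddCommGroup E] [NormedSpace ℝ E]
  {H : Type*} [TopologicalSpace H] {I : ModelWithCorners ℝ E H}
  {M : Type*} [TopologicalSpace M] [ChartedSpace H M]
  {E' : Type*} [NormedAddCommGroup E'] [NormedSpace ℝ E']
  {H' : Type*} [TopologicalSpace H'] {J : ModelWithCorners ℝ E' H'}
  {N : Type*} [TopologicalSpace N] [ChartedSpace H' N]

variable (I J) in
/-- The pullback `f^*g` of a field of bilinear forms on the tangent spaces of `N`. -/
def pullbackMetric (f : M → N) (g : Π y : N, TangentSpace J y →L[ℝ] TangentSpace J y →L[ℝ] ℝ)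
    (x : M) : TangentSpace I x →L[ℝ] TangentSpace I x →L[ℝ] ℝ :=
  ContinuousLinearMap.precomp ℝ (mfderiv I J f x) ∘L g (f x) ∘L mfderiv I J f x

/-- The warped product metric `π_M^*(g_M) + (φ ∘ π_M)² π_N^*(g_N)` on `M × N`. -/
def warpedMetric (gM : Π x : M, TangentSpace I x →L[ℝ] TangentSpace I x →L[ℝ] ℝ) (φ : M → ℝ)
    (gN : Π y : N, TangentSpace J y →L[ℝ] TangentSpace J y →L[ℝ] ℝ) (p : M × N) :
    TangentSpace (I.prod J) p →L[ℝ] TangentSpace (I.prod J) p →L[ℝ] ℝ :=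
  pullbackMetric (I.prod J) I Prod.fst gM p
    + φ p.1 ^ 2 • pullbackMetric (I.prod J) J Prod.snd gN p

variable (I M J) in
/-- The slice `x ↦ (b₀, x)` of a product of manifolds. -/
def sliceMap (b₀ : N) : C^∞⟮I, M; J.prod I, N × M⟯ :=
  ⟨fun x ↦ (b₀, x), contMDiff_const.prodMk contMDiff_id⟩

variable (I M J) in
/-- The lift `x ↦ (v, 0)` of a tangent vector `v` at `b₀` to a vector field along the slice. -/
def sliceLift (b₀ : N) (v : TangentSpace J b₀) (x : M) :
    (sliceMap I M J b₀ *ᵖ (TangentSpace (J.prod I) : N × M → Type _)) x :=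
  ((v, 0) : TangentSpace J b₀ × TangentSpace I x)

end Warped

/-! ### Spacelike immersions -/

section Submanifold

variable {n : ℕ} {M : Type*} [TopologicalSpace M] [ChartedSpace (EuclideanSpace ℝ (Fin n)) M]
  [IsManifold (𝓡 n) 1 M]
  {E' : Type*} [NormedAddCommGroup E'] [NormedSpace ℝ E']
  {H' : Type*} [TopologicalSpace H'] {J : ModelWithCorners ℝ E' H'}
  {N : Type*} [TopologicalSpace N] [ChartedSpace H' N] [IsManifold J 1 N]

/-- The connection induced along `f` by the Levi-Civita connection of the ambient metric, on the
pulled back bundle `f^*(TN)`, whose sections are the vector fields along `f`. -/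
def inducedConnection (f : C^∞⟮𝓡 n, M; J, N⟯)
    (gN : Π y : N, TangentSpace J y →L[ℝ] TangentSpace J y →L[ℝ] ℝ) :
    CovariantDerivative (𝓡 n) E' (f *ᵖ (TangentSpace J : N → Type _)) :=
  pullbackConnection (leviCivita gN) f

/-- The differential of `f` at `x`, with values in the fibre of `f^*(TN)`. -/
def differential (f : C^∞⟮𝓡 n, M; J, N⟯) (x : M) :
    TangentSpace (𝓡 n) x →L[ℝ] (f *ᵖ (TangentSpace J : N → Type _)) x :=
  mfderiv (𝓡 n) J f x

/-- The bundle metric on `f^*(TN)` given by the metric of `N`. -/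
def bundleMetric (f : C^∞⟮𝓡 n, M; J, N⟯)
    (gN : Π y : N, TangentSpace J y →L[ℝ] TangentSpace J y →L[ℝ] ℝ) (x : M) :
    (f *ᵖ (TangentSpace J : N → Type _)) x →L[ℝ] (f *ᵖ (TangentSpace J : N → Type _)) x →L[ℝ] ℝ :=
  gN (f x)

/-- The second fundamental form of the immersion `f` at `x`, by the Gauss formula
`II(v, w) = ∇̃_v (df(W)) - df(∇_v W)`, where `∇` is the Levi-Civita connection of the induced
metric and `W` is a local vector field with value `w` at `x`. -/
def secondFundamentalForm (f : C^∞⟮𝓡 n, M; J, N⟯)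
    (gN : Π y : N, TangentSpace J y →L[ℝ] TangentSpace J y →L[ℝ] ℝ)
    (x : M) (v w : TangentSpace (𝓡 n) x) : (f *ᵖ (TangentSpace J : N → Type _)) x :=
  inducedConnection f gN
      (fun y ↦ differential f y (FiberBundle.extend (EuclideanSpace ℝ (Fin n)) w y)) x v
    - differential f x (leviCivita (pullbackMetric (𝓡 n) J f gN)
        (FiberBundle.extend (EuclideanSpace ℝ (Fin n)) w) x v)

/-- The mean curvature vector `H = (1/n) trace_g II`, where `g` is the induced metric; the trace is
`∑ i, II(e_i, g⁻¹ eⁱ)` with `e` the standard basis of the tangent space and `eⁱ` the dual one. -/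
def meanCurvature (f : C^∞⟮𝓡 n, M; J, N⟯)
    (gN : Π y : N, TangentSpace J y →L[ℝ] TangentSpace J y →L[ℝ] ℝ) (x : M) :
    (f *ᵖ (TangentSpace J : N → Type _)) x :=
  (1 / n : ℝ) • ∑ i : Fin n, secondFundamentalForm f gN x (EuclideanSpace.single i (1 : ℝ))
    ((pullbackMetric (𝓡 n) J f gN x).inverse
      (EuclideanSpace.proj i : EuclideanSpace ℝ (Fin n) →L[ℝ] ℝ))

/-- `Ric = Λ g`, where `Ric(X, Y) = ∑ i, g(R(E_i, X)Y, E_i)` and `R` is the curvature of the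
Levi-Civita connection of `g`. The value of this sum at `x` depends on the frame `E` at `x` only,
which is therefore required to be orthonormal only there. -/
def IsEinsteinWith (g : Π x : M, TangentSpace (𝓡 n) x →L[ℝ] TangentSpace (𝓡 n) x →L[ℝ] ℝ)
    (Λ : ℝ) : Prop :=
  ∀ (E : Fin n → Π x : M, TangentSpace (𝓡 n) x) (X Y : Π x : M, TangentSpace (𝓡 n) x) (x : M),
    (∀ i, IsSmoothField (𝓡 n) (E i)) → IsSmoothField (𝓡 n) X → IsSmoothField (𝓡 n) Y →
    (∀ i j, g x (E i x) (E j x) = if i = j then 1 else 0) →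
    ∑ i, g x (curvature (leviCivita g) (E i) X Y x) (E i x) = Λ * g x (X x) (Y x)

end Submanifold

/-! ### Tractor conformal bundles -/

section Tractor

variable {n : ℕ} {M : Type*} [TopologicalSpace M] [ChartedSpace (EuclideanSpace ℝ (Fin n)) M]
  [IsManifold (𝓡 n) 1 M]
  {F : Type*} [NormedAddCommGroup F] [NormedSpace ℝ F]
  {V : M → Type*} [TopologicalSpace (TotalSpace F V)]
  [∀ x, AddCommGroup (V x)] [∀ x, Module ℝ (V x)] [∀ x, TopologicalSpace (V x)]
  [∀ x, IsTopologicalAddGroup (V x)] [∀ x, ContinuousSMul ℝ (V x)]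
  [FiberBundle F V] [VectorBundle ℝ F V]

variable (F) in
/-- `σ` is a smooth section of the line subbundle `T1` of `V`. -/
structure IsLineSection (T1 : Π x, Submodule ℝ (V x)) (σ : Π x, V x) : Prop where
  smooth : IsSmoothSection (𝓡 n) F σ
  mem : ∀ x, σ x ∈ T1 x

variable (F) in
/-- `(V, T1, h)` is a tractor conformal bundle over the `n`-dimensional manifold `M`: a vector
bundle of rank `n + 2` with a Lorentzian bundle metric `h` and a lightlike line subbundle `T1`. -/
structure IsTractorBundle (h : Π x, V x →L[ℝ] V x →L[ℝ] ℝ) (T1 : Π x, Submodule ℝ (V x)) :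
    Prop where
  rank : ∀ x, Module.finrank ℝ (V x) = n + 2
  lorentz : ∀ x, IsLorentzForm (h x)
  smooth : ∀ σ τ : Π x, V x, IsSmoothSection (𝓡 n) F σ → IsSmoothSection (𝓡 n) F τ →
    ContMDiff (𝓡 n) 𝓘(ℝ, ℝ) ∞ (fun x ↦ h x (σ x) (τ x))
  line : ∀ x, Module.finrank ℝ (T1 x) = 1
  line_smooth : ∀ x, ∃ σ : Π x, V x, IsLineSection (n := n) F T1 σ ∧ σ x ≠ 0
  lightlike : ∀ x, ∀ v ∈ T1 x, h x v v = 0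

/-- The orthogonal complement of the line subbundle. -/
def lineOrth (h : Π x, V x →L[ℝ] V x →L[ℝ] ℝ) (T1 : Π x, Submodule ℝ (V x)) (x : M) :
    Submodule ℝ (V x) where
  carrier := {v | ∀ w ∈ T1 x, h x w v = 0}
  add_mem' := by
    intro a b ha hb w hw
    simp [ha w hw, hb w hw]
  zero_mem' := by
    intro w _
    simp
  smul_mem' := by
    intro c a ha w hw
    simp [ha w hw]

/-- `cov` is a tractor connection on `(V, T1, h)`: a smooth linear connection with `∇h = 0` for
which `β : TM → Hom(T1, T1^⊥ / T1)`, `β(v)(σ(x)) = [∇_v σ]` for every section `σ` of `T1`, is an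
isomorphism of vector bundles. -/
structure IsTractorConnection (h : Π x, V x →L[ℝ] V x →L[ℝ] ℝ) (T1 : Π x, Submodule ℝ (V x))
    (cov : CovariantDerivative (𝓡 n) F V) : Prop where
  smooth : ∀ (X : Π x : M, TangentSpace (𝓡 n) x) (σ : Π x, V x), IsSmoothField (𝓡 n) X →
    IsSmoothSection (𝓡 n) F σ → IsSmoothSection (𝓡 n) F (fun x ↦ cov σ x (X x))
  metric : ∀ σ τ : Π x, V x, IsSmoothSection (𝓡 n) F σ → IsSmoothSection (𝓡 n) F τ →
    ∀ (x : M) (v : TangentSpace (𝓡 n) x),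
      mvfderiv (𝓡 n) (fun y ↦ h y (σ y) (τ y)) x v
        = h x (cov σ x v) (τ x) + h x (σ x) (cov τ x v)
  beta : ∃ β : Π x : M, TangentSpace (𝓡 n) x ≃ₗ[ℝ]
      (T1 x →ₗ[ℝ] (lineOrth h T1 x ⧸ (T1 x).submoduleOf (lineOrth h T1 x))),
    ∀ (σ : Π x, V x) (hσ : IsLineSection (n := n) F T1 σ) (x : M) (v : TangentSpace (𝓡 n) x),
      ∃ hmem : cov σ x v ∈ lineOrth h T1 x,
        β x v ⟨σ x, hσ.mem x⟩ = Submodule.Quotient.mk ⟨cov σ x v, hmem⟩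

/-- `(V, T1, h, cov)` is a standard tractor conformal bundle for the conformal class of the metric
`g`: it is a tractor conformal bundle with a tractor connection, and for every section `σ` of `T1`
the form `h^σ(v, w) = h(β_σ(v), β_σ(w)) = h(∇_v σ, ∇_w σ)` is a smooth multiple of `g`, with a
positive factor wherever `σ` does not vanish. -/
structure IsStandardTractor (g : Π x : M, TangentSpace (𝓡 n) x →L[ℝ] TangentSpace (𝓡 n) x →L[ℝ] ℝ)
    (h : Π x, V x →L[ℝ] V x →L[ℝ] ℝ) (T1 : Π x, Submodule ℝ (V x))
    (cov : CovariantDerivative (𝓡 n) F V) : Prop where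
  bundle : IsTractorBundle (n := n) F h T1
  connection : IsTractorConnection h T1 cov
  conformal : ∀ σ : Π x, V x, IsLineSection (n := n) F T1 σ →
    ∃ ρ : M → ℝ, ContMDiff (𝓡 n) 𝓘(ℝ, ℝ) ∞ ρ ∧ (∀ x, σ x ≠ 0 → 0 < ρ x) ∧
      ∀ (x : M) (v w : TangentSpace (𝓡 n) x), h x (cov σ x v) (cov σ x w) = ρ x * g x v w

/-- The tractor connection `cov` is normal: its curvature maps `T1` into itself, and the
Ricci type contraction `∑ i, h(R(E_i, X) β_σ(Y), β_σ(E_i))` vanishes for every section `σ` of `T1`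
and every frame `E` that is orthonormal for `h^σ`. The value of this sum at `x` depends on the
values at `x` of `E`, `X`, `Y`, `σ` only, and `h^σ` can have an orthonormal frame at `x` only if
`σ` does not vanish there; `∇_Y σ` represents the class `β_σ(Y)` modulo `T1`. -/
structure IsNormalTractor (h : Π x, V x →L[ℝ] V x →L[ℝ] ℝ) (T1 : Π x, Submodule ℝ (V x))
    (cov : CovariantDerivative (𝓡 n) F V) : Prop where
  curvature_mem : ∀ (X Y : Π x : M, TangentSpace (𝓡 n) x) (σ : Π x, V x),
    IsSmoothField (𝓡 n) X → IsSmoothField (𝓡 n) Y → IsLineSection (n := n) F T1 σ →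
    ∀ x, curvature cov X Y σ x ∈ T1 x
  ricci_eq_zero : ∀ (E : Fin n → Π x : M, TangentSpace (𝓡 n) x)
    (X Y : Π x : M, TangentSpace (𝓡 n) x) (σ : Π x, V x) (x : M),
    (∀ i, IsSmoothField (𝓡 n) (E i)) → IsSmoothField (𝓡 n) X → IsSmoothField (𝓡 n) Y →
    IsLineSection (n := n) F T1 σ →
    (∀ i j, h x (cov σ x (E i x)) (cov σ x (E j x)) = if i = j then 1 else 0) →
    ∑ i, h x (curvature cov (E i) X (fun y ↦ cov σ y (Y y)) x) (cov σ x (E i x)) = 0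

end Tractor

end

/-! Along the slice the base point is fixed, so sections of the pulled back bundle are pairs `(u,
W)`: a function `u` with values in the fixed plane `E'` and a vector field `W` on `M`. Write `G` for
the gradient of `φ` at `b₀`. The Christoffel symbols of the warped metric with one argument tangent
to the slice involve no derivative of the base metric, and since `φ b₀ = 1` they give `∇_v (u, W) =
(du(v) - g(v, W) G, ∇^g_v W + dφ(u) v)`, which is `pullbackConnection_sliceSection`. Everything else
is read off from this formula.

For a section `σ = a ξ` of the line bundle, `∇_v σ = (da(v) ξ, a dφ(ξ) v)`. In a Lorentzian plane
the orthogonal of a lightlike line is that line, so the quotient of the orthogonal of the line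
bundle by the line bundle is `TM`, and `β_σ` is multiplication by `a dφ(ξ)`. It is invertible
exactly because `dφ(ξ) ≠ 0`, and `h^σ = (a dφ(ξ))² g`. This is (1).

Differentiating twice, the `TM` component of the curvature is `R^g(X, Y)W - dφ(G) (g(Y, W) X - g(X,
W) Y)` (`curvature_pullbackConnection_sliceSection`), while the base component is the curvature of
the trivial connection on `u`. Hence the curvature always preserves the line bundle, and normality
is only the trace condition. Up to nonzero factors the trace is `Ric - (n - 1) dφ(G) g`, so it
vanishes iff `g` is Einstein with constant `(n - 1) dφ(G)`. Finally `dφ(G)` is the square of the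
gradient, and taking `u = 0` in the formula for `∇` gives `II = -g G`, so `H = -G` has the same
square.

The connections are defined pointwise through preferred charts, so the Levi-Civita connection is
first shown to be metric, torsion free and smooth. -/

noncomputable section

/-! ### The Levi-Civita connection of a pseudo-Riemannian metric. -/

section LeviCivitaTheory

variable {E : Type*} [NormedAddCommGroup E] [NormedSpace ℝ E]
  {H : Type*} [TopologicalSpace H] {I : ModelWithCorners ℝ E H}
  {M : Type*} [TopologicalSpace M] [ChartedSpace H M]

/-- A smooth field of nondegenerate symmetric bilinear forms on the tangent spaces. -/
structure IsSmoothMetric [IsManifold I 1 M]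
    (g : Π x : M, TangentSpace I x →L[ℝ] TangentSpace I x →L[ℝ] ℝ) : Prop where
  contMDiff : ContMDiff I (I.prod 𝓘(ℝ, E →L[ℝ] E →L[ℝ] ℝ)) ∞
    (fun x ↦ TotalSpace.mk' (E →L[ℝ] E →L[ℝ] ℝ) (E := fun x : M ↦
      TangentSpace I x →L[ℝ] TangentSpace I x →L[ℝ] ℝ) x (g x))
  symm : ∀ x v w, g x v w = g x w v
  nondegenerate : ∀ x v, (∀ w, g x v w = 0) → v = 0

/-- A chart has trivial coordinate change with itself. At the centre of the preferred chart, vectors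
and tensors therefore equal their own components, and coordinate formulas hold there without
transition maps. -/
theorem trivializationAt_symmL_self [IsManifold I 1 M] (x : M) :
    (trivializationAt E (TangentSpace I) x).symmL ℝ x =
      (ContinuousLinearMap.id ℝ E : E →L[ℝ] TangentSpace I x) := by
  rw [TangentBundle.symmL_trivializationAt_eq_core (mem_chart_source H x)]
  ext v
  exact (tangentBundleCore I M).coordChange_self (achart H x) x (mem_chart_source H x) v

theorem trivializationAt_continuousLinearMapAt_self [IsManifold I 1 M] (x : M) :
    (trivializationAt E (TangentSpace I) x).continuousLinearMapAt ℝ x =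
      (ContinuousLinearMap.id ℝ E : TangentSpace I x →L[ℝ] E) := by
  rw [TangentBundle.continuousLinearMapAt_trivializationAt_eq_core (mem_chart_source H x)]
  ext v
  exact (tangentBundleCore I M).coordChange_self (achart H x) x (mem_chart_source H x) v

theorem trivializationAt_snd_eq_continuousLinearMapAt [IsManifold I 1 M] {x y : M}
    (hy : y ∈ (chartAt H x).source) (v : TangentSpace I y) :
    (trivializationAt E (TangentSpace I) x ⟨y, v⟩).2 =
      (trivializationAt E (TangentSpace I) x).continuousLinearMapAt ℝ y v := by
  rw [Trivialization.continuousLinearMapAt_apply, Trivialization.coe_linearMapAt_of_mem]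
  exact hy

theorem symmL_continuousLinearMapAt_apply [IsManifold I 1 M] {x y : M}
    (hy : y ∈ (chartAt H x).source) (v : TangentSpace I y) :
    (trivializationAt E (TangentSpace I) x).symmL ℝ y
      ((trivializationAt E (TangentSpace I) x).continuousLinearMapAt ℝ y v) = v :=
  Trivialization.symmL_continuousLinearMapAt _ hy v

variable [IsManifold I 1 M]

theorem metricCoord_apply (g : Π x : M, TangentSpace I x →L[ℝ] TangentSpace I x →L[ℝ] ℝ) (x y : M)
    (v w : E) : metricCoord g x y v w =
      g y ((trivializationAt E (TangentSpace I) x).symmL ℝ y v)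
        ((trivializationAt E (TangentSpace I) x).symmL ℝ y w) :=
  rfl

theorem metricCoord_self (g : Π x : M, TangentSpace I x →L[ℝ] TangentSpace I x →L[ℝ] ℝ) (x : M) :
    metricCoord g x x = g x := by
  ext v w
  rw [metricCoord_apply, trivializationAt_symmL_self]
  rfl

theorem metric_eq_metricCoord (g : Π x : M, TangentSpace I x →L[ℝ] TangentSpace I x →L[ℝ] ℝ)
    {x y : M} (hy : y ∈ (chartAt H x).source) (v w : TangentSpace I y) :
    g y v w = metricCoord g x y (trivializationAt E (TangentSpace I) x ⟨y, v⟩).2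
      (trivializationAt E (TangentSpace I) x ⟨y, w⟩).2 := by
  rw [metricCoord_apply, trivializationAt_snd_eq_continuousLinearMapAt hy,
    trivializationAt_snd_eq_continuousLinearMapAt hy, symmL_continuousLinearMapAt_apply hy,
    symmL_continuousLinearMapAt_apply hy]

/-- Identifies the matrix of the metric with its components in the bundle of bilinear forms, so that
smoothness of the metric as a section passes to its matrix. -/
theorem metricCoord_eq_trivializationAt
    (g : Π x : M, TangentSpace I x →L[ℝ] TangentSpace I x →L[ℝ] ℝ)
    {x y : M} (hy : y ∈ (chartAt H x).source) :
    metricCoord g x y = (trivializationAt (E →L[ℝ] E →L[ℝ] ℝ) (fun x : M ↦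
      TangentSpace I x →L[ℝ] TangentSpace I x →L[ℝ] ℝ) x ⟨y, g y⟩).2 := by
  rw [hom_trivializationAt_apply]
  ext v w
  change _ = ContinuousLinearMap.inCoordinates E (TangentSpace I) (E →L[ℝ] ℝ)
    (fun x : M ↦ TangentSpace I x →L[ℝ] Trivial M ℝ x) x y x y (g y) v w
  rw [inCoordinates_apply_eq₂ hy hy (Set.mem_univ _), metricCoord_apply,
    Trivialization.symmL_apply _ hy, Trivialization.symmL_apply _ hy]
  simp

theorem leviCivitaForm_apply (g : Π x : M, TangentSpace I x →L[ℝ] TangentSpace I x →L[ℝ] ℝ) (x : M)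
    (s v : E) : (leviCivitaForm g x s v : E) = christoffel g x s v := by
  change (trivializationAt E (TangentSpace I) x).symmL ℝ x
    (christoffel g x ((trivializationAt E (TangentSpace I) x).continuousLinearMapAt ℝ x s)
      ((trivializationAt E (TangentSpace I) x).continuousLinearMapAt ℝ x v)) = _
  rw [trivializationAt_continuousLinearMapAt_self, trivializationAt_symmL_self]
  rfl

theorem metricCoordDeriv_eq (g : Π x : M, TangentSpace I x →L[ℝ] TangentSpace I x →L[ℝ] ℝ)
    (x : M) : metricCoordDeriv g x = mvfderiv I (metricCoord g x) x := by
  ext u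
  simp only [metricCoordDeriv, trivializationAt_symmL_self]
  rfl

/-! ### Product and chain rules for vector valued functions on a manifold. -/

section Calculus

variable {F G : Type*} [NormedAddCommGroup F] [NormedSpace ℝ F]
  [NormedAddCommGroup G] [NormedSpace ℝ G]

omit [IsManifold I 1 M] in
theorem mvfderiv_comp_fderiv {Φ : F → G} {s : M → F} {x : M} {Φ' : F →L[ℝ] G}
    (hΦ : HasFDerivAt Φ Φ' (s x))
    (hs : MDifferentiableAt I 𝓘(ℝ, F) s x) (v : TangentSpace I x) :
    mvfderiv I (fun y ↦ Φ (s y)) x v = Φ' (mvfderiv I s x v) := by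
  have h := (hΦ.hasMFDerivAt.comp x hs.hasMFDerivAt).mfderiv
  have h2 := congrArg (fun L ↦ L v) h
  exact h2

omit [IsManifold I 1 M] in
theorem mvfderiv_prodMk {s : M → F} {t : M → G} {x : M}
    (hs : MDifferentiableAt I 𝓘(ℝ, F) s x) (ht : MDifferentiableAt I 𝓘(ℝ, G) t x)
    (v : TangentSpace I x) :
    mvfderiv I (fun y ↦ (s y, t y)) x v = (mvfderiv I s x v, mvfderiv I t x v) := by
  have hst := hs.prodMk_space ht
  refine Prod.ext ?_ ?_
  · exact (mvfderiv_comp_fderiv (Φ := Prod.fst) (ContinuousLinearMap.fst ℝ F G).hasFDerivAt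
      hst v).symm
  · exact (mvfderiv_comp_fderiv (Φ := Prod.snd) (ContinuousLinearMap.snd ℝ F G).hasFDerivAt
      hst v).symm

omit [IsManifold I 1 M] in
theorem mvfderiv_clm_apply {b : M → F →L[ℝ] G} {s : M → F} {x : M}
    (hb : MDifferentiableAt I 𝓘(ℝ, F →L[ℝ] G) b x) (hs : MDifferentiableAt I 𝓘(ℝ, F) s x)
    (v : TangentSpace I x) :
    mvfderiv I (fun y ↦ b y (s y)) x v = mvfderiv I b x v (s x) + b x (mvfderiv I s x v) := by
  have h : HasFDerivAt (fun p : (F →L[ℝ] G) × F ↦ p.1 p.2) _ (b x, s x) :=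
    (hasFDerivAt_fst (p := (b x, s x))).clm_apply hasFDerivAt_snd
  have h2 := mvfderiv_comp_fderiv (s := fun y ↦ (b y, s y)) h (hb.prodMk_space hs) v
  rw [mvfderiv_prodMk hb hs] at h2
  simpa [add_comm] using h2

omit [IsManifold I 1 M] in
theorem mvfderiv_clm_apply₂ {b : M → F →L[ℝ] F →L[ℝ] G} {s t : M → F} {x : M}
    (hb : MDifferentiableAt I 𝓘(ℝ, F →L[ℝ] F →L[ℝ] G) b x)
    (hs : MDifferentiableAt I 𝓘(ℝ, F) s x) (ht : MDifferentiableAt I 𝓘(ℝ, F) t x)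
    (v : TangentSpace I x) :
    mvfderiv I (fun y ↦ b y (s y) (t y)) x v = mvfderiv I b x v (s x) (t x)
      + b x (mvfderiv I s x v) (t x) + b x (s x) (mvfderiv I t x v) := by
  rw [mvfderiv_clm_apply (hb.clm_apply hs) ht, mvfderiv_clm_apply hb hs]
  rfl

end Calculus

/-- A nondegenerate form is an injection into the dual space, which has the same dimension.
Invertibility matters because `ContinuousLinearMap.inverse` is zero on maps that are not invertible.
-/
theorem isInvertible_of_nondegenerate {F : Type*} [NormedAddCommGroup F] [NormedSpace ℝ F]
    [FiniteDimensional ℝ F] {b : F →L[ℝ] F →L[ℝ] ℝ}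
    (h : ∀ v, (∀ w, b v w = 0) → v = 0) : b.IsInvertible := by
  have hinj : Function.Injective b := by
    rw [injective_iff_map_eq_zero]
    intro v hv
    exact h v fun w ↦ by rw [hv]; rfl
  have hfr : Module.finrank ℝ F = Module.finrank ℝ (F →L[ℝ] ℝ) := by
    rw [← (LinearMap.toContinuousLinearMap (𝕜 := ℝ) (E := F) (F' := ℝ)).finrank_eq,
      Subspace.dual_finrank_eq]
  exact ⟨(LinearEquiv.ofInjectiveOfFinrankEq b.toLinearMap hinj hfr).toContinuousLinearEquiv,
    by ext; rfl⟩

section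

variable {g : Π x : M, TangentSpace I x →L[ℝ] TangentSpace I x →L[ℝ] ℝ}

theorem IsSmoothMetric.contMDiffAt_metricCoord (hg : IsSmoothMetric g) (x : M) :
    ContMDiffAt I 𝓘(ℝ, E →L[ℝ] E →L[ℝ] ℝ) ∞ (metricCoord g x) x := by
  have h := (contMDiffAt_section x).1 (hg.contMDiff x)
  refine h.congr_of_eventuallyEq ?_
  filter_upwards [(chartAt H x).open_source.mem_nhds (mem_chart_source H x)] with z hz
  exact metricCoord_eq_trivializationAt g hz

theorem IsSmoothMetric.mdifferentiableAt_metricCoord (hg : IsSmoothMetric g) (x : M) :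
    MDifferentiableAt I 𝓘(ℝ, E →L[ℝ] E →L[ℝ] ℝ) (metricCoord g x) x :=
  (hg.contMDiffAt_metricCoord x).mdifferentiableAt (by simp)

theorem metricCoord_symm (hg : IsSmoothMetric g) (x y : M) (v w : E) :
    metricCoord g x y v w = metricCoord g x y w v :=
  hg.symm y _ _

omit [IsManifold I 1 M] in
theorem mvfderiv_clm_apply₂_const {F : Type*} [NormedAddCommGroup F] [NormedSpace ℝ F]
    {b : M → F →L[ℝ] F →L[ℝ] ℝ} {x : M}
    (hb : MDifferentiableAt I 𝓘(ℝ, F →L[ℝ] F →L[ℝ] ℝ) b x) (v : TangentSpace I x) (s t : F) :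
    mvfderiv I b x v s t = mvfderiv I (fun y ↦ b y s t) x v := by
  rw [mvfderiv_clm_apply₂ hb (mdifferentiableAt_const)
    (mdifferentiableAt_const), mvfderiv_const, mvfderiv_const]
  change _ = _ + b x 0 t + b x s 0
  simp

theorem IsSmoothMetric.metricCoordDeriv_symm (hg : IsSmoothMetric g) (x : M) (u v w : E) :
    metricCoordDeriv g x u v w = metricCoordDeriv g x u w v := by
  have h := hg.mdifferentiableAt_metricCoord x
  rw [metricCoordDeriv_eq]
  refine (mvfderiv_clm_apply₂_const h u v w).trans
    (Eq.trans ?_ (mvfderiv_clm_apply₂_const h u w v).symm)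
  congr 2
  ext y
  exact metricCoord_symm hg x y v w

theorem IsSmoothMetric.isInvertible [FiniteDimensional ℝ E] (hg : IsSmoothMetric g) (x : M) :
    (g x).IsInvertible :=
  isInvertible_of_nondegenerate (F := E) (hg.nondegenerate x)

theorem IsSmoothMetric.isInvertible_metricCoord [FiniteDimensional ℝ E] (hg : IsSmoothMetric g)
    (x : M) : (metricCoord g x x).IsInvertible := by
  rw [metricCoord_self]
  exact hg.isInvertible x

/-- The defining relation of the Christoffel symbols. Invertibility of the matrix is what turns the
formal `inverse` in `christoffel` into an actual solution of it. -/
theorem metricCoord_christoffel {x : M} (hx : (metricCoord g x x).IsInvertible) (s v z : E) :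
    2 * metricCoord g x x (christoffel g x s v) z = metricCoordDeriv g x v s z
      + metricCoordDeriv g x s v z - metricCoordDeriv g x z s v := by
  obtain ⟨e, he⟩ := hx
  have h : metricCoord g x x (christoffel g x s v) = (1 / 2 : ℝ) • koszulForm g x s v := by
    change metricCoord g x x ((1 / 2 : ℝ) • (metricCoord g x x).inverse (koszulForm g x s v)) = _
    rw [map_smul, ← he, ContinuousLinearMap.inverse_equiv]
    congr 1
    exact e.apply_symm_apply _
  rw [h, ← koszulForm_apply]
  change 2 * ((1 / 2 : ℝ) * koszulForm g x s v z) = _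
  ring

theorem leviCivita_apply (X : Π x : M, TangentSpace I x) (x : M) (v : TangentSpace I x) :
    @Eq E (leviCivita g X x v)
      (mvfderiv I (fun y ↦ (trivializationAt E (TangentSpace I) x ⟨y, X y⟩).2) x v
        + christoffel g x (X x) v) := by
  have h : @Eq E (trivDeriv I E X x v)
      (mvfderiv I (fun y ↦ (trivializationAt E (TangentSpace I) x ⟨y, X y⟩).2) x v) := by
    change (trivializationAt E (TangentSpace I) x).symmL ℝ x _ = _
    rw [trivializationAt_symmL_self]
    rfl
  exact congrArg₂ (fun a b : E ↦ a + b) h (leviCivitaForm_apply g x (X x) v)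

theorem trivializationAt_self_snd (x : M) (v : TangentSpace I x) :
    (trivializationAt E (TangentSpace I) x ⟨x, v⟩).2 = v := by
  rw [trivializationAt_snd_eq_continuousLinearMapAt (mem_chart_source H x),
    trivializationAt_continuousLinearMapAt_self]
  rfl

/-- The Levi-Civita connection is compatible with the metric. -/
theorem mvfderiv_metric_eq [FiniteDimensional ℝ E] (hg : IsSmoothMetric g)
    {X Y : Π x : M, TangentSpace I x} {x : M}
    (hX : MDifferentiableAt I (I.prod 𝓘(ℝ, E)) (fun y ↦ TotalSpace.mk' E y (X y)) x)
    (hY : MDifferentiableAt I (I.prod 𝓘(ℝ, E)) (fun y ↦ TotalSpace.mk' E y (Y y)) x)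
    (v : TangentSpace I x) :
    mvfderiv I (fun y ↦ g y (X y) (Y y)) x v =
      g x (leviCivita g X x v) (Y x) + g x (X x) (leviCivita g Y x v) := by
  rw [mdifferentiableAt_section] at hX hY
  have h1 : (fun y ↦ g y (X y) (Y y)) =ᶠ[nhds x] fun y ↦ metricCoord g x y
      (trivializationAt E (TangentSpace I) x ⟨y, X y⟩).2
      (trivializationAt E (TangentSpace I) x ⟨y, Y y⟩).2 := by
    filter_upwards [(chartAt H x).open_source.mem_nhds (mem_chart_source H x)] with y hy
    exact metric_eq_metricCoord g hy _ _
  -- Pointwise content of `∇g = 0`: lowering the index, `Γ(v, a)` paired with `b` plus `Γ(v, b)`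
  -- paired with `a` adds up to the `v`-derivative of `g(a, b)`; the other derivatives cancel by
  -- symmetry of the matrix.
  have h2 (v a b a' b' : E) : metricCoordDeriv g x v a b + metricCoord g x x a' b
      + metricCoord g x x a b' = metricCoord g x x (a' + christoffel g x a v) b
        + metricCoord g x x a (b' + christoffel g x b v) := by
    have h3 := metricCoord_christoffel (hg.isInvertible_metricCoord x) a v b
    have h4 := metricCoord_christoffel (hg.isInvertible_metricCoord x) b v a
    have h5 := metricCoord_symm hg x x a (christoffel g x b v)
    have h6 := hg.metricCoordDeriv_symm x v a b
    have h7 := hg.metricCoordDeriv_symm x a v b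
    have h8 := hg.metricCoordDeriv_symm x b v a
    rw [map_add, map_add, _root_.add_apply]
    linarith
  have h3 := mvfderiv_clm_apply₂ (hg.mdifferentiableAt_metricCoord x) hX hY v
  rw [trivializationAt_self_snd, trivializationAt_self_snd] at h3
  rw [mvfderiv_congr h1, h3, ← metricCoordDeriv_eq]
  refine (h2 _ _ _ _ _).trans ?_
  rw [metricCoord_self]
  exact congrArg₂ (fun a b : ℝ ↦ a + b)
    (congrArg (fun z : E ↦ g x z (Y x)) (leviCivita_apply X x v).symm)
    (congrArg (fun z : E ↦ g x (X x) z) (leviCivita_apply Y x v).symm)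

theorem metricCoord_nondegenerate (hg : IsSmoothMetric g) (x : M) (v : E)
    (hv : ∀ w, metricCoord g x x v w = 0) : v = 0 := by
  rw [metricCoord_self] at hv
  exact hg.nondegenerate x v hv

theorem christoffel_symm [FiniteDimensional ℝ E] (hg : IsSmoothMetric g) (x : M)
    (v w : E) : christoffel g x v w = christoffel g x w v := by
  rw [← sub_eq_zero]
  refine metricCoord_nondegenerate hg x _ fun z ↦ ?_
  have h2 := metricCoord_christoffel (hg.isInvertible_metricCoord x) v w z
  have h3 := metricCoord_christoffel (hg.isInvertible_metricCoord x) w v z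
  have h4 := hg.metricCoordDeriv_symm x z v w
  rw [map_sub, _root_.sub_apply]
  linarith

end

/-- The extension has constant components in the chart at `x`, so its coordinate derivative vanishes
and only the Christoffel term survives. -/
theorem leviCivita_extend {g : Π x : M, TangentSpace I x →L[ℝ] TangentSpace I x →L[ℝ] ℝ} (x : M)
    (s v : TangentSpace I x) :
    @Eq E (leviCivita g (FiberBundle.extend E s) x v) (christoffel g x s v) := by
  have h : (fun y ↦ (trivializationAt E (TangentSpace I) x ⟨y, FiberBundle.extend E s y⟩).2)
      =ᶠ[nhds x] fun _ ↦ (trivializationAt E (TangentSpace I) x ⟨x, s⟩).2 := by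
    filter_upwards [(chartAt H x).open_source.mem_nhds (mem_chart_source H x)] with y hy
    rw [FiberBundle.extend, Trivialization.apply_mk_symm _ hy]
  have h2 := leviCivita_apply (g := g) (FiberBundle.extend E s) x v
  rw [mvfderiv_congr h, mvfderiv_const] at h2
  rw [h2, FiberBundle.extend_apply_self]
  exact zero_add _

/-- Extending with constant components in the tangent trivialization at `x` means moving `u` by the
differential of the inverse chart; pulling back by that chart undoes this. The field is thus
constant in coordinates, and two such fields commute. -/
theorem mpullbackWithin_extend {x : M} (u : TangentSpace I x) :
    ∀ z ∈ (extChartAt I x).target, @Eq E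
      (VectorField.mpullbackWithin 𝓘(ℝ, E) I (extChartAt I x).symm
        (FiberBundle.extend E u) (Set.range I) z) u := by
  intro z hz
  have hs : (extChartAt I x).symm z ∈ (chartAt H x).source := by
    rw [← extChartAt_source I]
    exact (extChartAt I x).map_target hz
  have h1 := TangentBundle.symmL_trivializationAt (I := I) hs
  rw [(extChartAt I x).right_inv hz] at h1
  rw [VectorField.mpullbackWithin_apply]
  have h2 : FiberBundle.extend E u ((extChartAt I x).symm z) =
      mfderivWithin 𝓘(ℝ, E) I (extChartAt I x).symm (Set.range I) z u := by
    rw [← h1, FiberBundle.extend, trivializationAt_self_snd]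
    exact ((trivializationAt E (TangentSpace I) x).symmL_apply hs u).symm
  rw [h2]
  obtain ⟨e, he⟩ := isInvertible_mfderivWithin_extChartAt_symm (I := I) hz
  rw [← he, ContinuousLinearMap.inverse_equiv]
  exact e.symm_apply_apply u

theorem mlieBracket_extend {x : M} (v w : TangentSpace I x) :
    VectorField.mlieBracket I (FiberBundle.extend E v) (FiberBundle.extend E w) x = 0 := by
  rw [← VectorField.mlieBracketWithin_univ, VectorField.mlieBracketWithin_apply]
  have key (u : TangentSpace I x) : @Filter.EventuallyEq E E
      (nhdsWithin (extChartAt I x x) ((extChartAt I x).symm ⁻¹' Set.univ ∩ Set.range I))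
      (VectorField.mpullbackWithin 𝓘(ℝ, E) I (extChartAt I x).symm
        (FiberBundle.extend E u) (Set.range I)) (fun _ ↦ u) := by
    rw [Set.preimage_univ, Set.univ_inter]
    filter_upwards [extChartAt_target_mem_nhdsWithin (I := I) x] with z hz
    exact mpullbackWithin_extend u z hz
  have h := Filter.EventuallyEq.lieBracketWithin_vectorField_eq_of_mem (𝕜 := ℝ) (key v) (key w)
    ⟨Set.mem_univ _, mem_extChartAt_target x |> extChartAt_target_subset_range x⟩
  have h0 (v w : E) : VectorField.lieBracketWithin ℝ (fun _ : E ↦ v) (fun _ ↦ w)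
      ((extChartAt I x).symm ⁻¹' Set.univ ∩ Set.range I) (extChartAt I x x) = 0 := by
    simp [VectorField.lieBracketWithin]
  exact (congrArg (mfderiv I 𝓘(ℝ, E) (extChartAt I x) x).inverse (h.trans (h0 v w))).trans (map_zero _)

section

variable {g : Π x : M, TangentSpace I x →L[ℝ] TangentSpace I x →L[ℝ] ℝ}

/-- The Levi-Civita connection is torsion free. -/
theorem leviCivita_torsion_free [FiniteDimensional ℝ E] [IsManifold I 2 M] (hg : IsSmoothMetric g)
    {X Y : Π x : M, TangentSpace I x} {x : M}
    (hX : MDifferentiableAt I (I.prod 𝓘(ℝ, E)) (fun y ↦ TotalSpace.mk' E y (X y)) x)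
    (hY : MDifferentiableAt I (I.prod 𝓘(ℝ, E)) (fun y ↦ TotalSpace.mk' E y (Y y)) x) :
    leviCivita g Y x (X x) - leviCivita g X x (Y x) = VectorField.mlieBracket I X Y x := by
  have : CompleteSpace E := FiniteDimensional.complete ℝ E
  -- Torsion is a tensor, so it can be tested on fields with constant components: their bracket
  -- vanishes and what remains is the symmetry of the Christoffel symbols.
  refine (leviCivita g).torsion_eq_zero_iff.1 ?_ hX hY
  ext x u v : 3
  rw [CovariantDerivative.torsion_apply_eq_extend, mlieBracket_extend, sub_zero,
    FiberBundle.extend_apply_self, FiberBundle.extend_apply_self]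
  refine sub_eq_zero.2 ?_
  exact (leviCivita_extend x v u).trans ((christoffel_symm hg x v u).trans
    (leviCivita_extend x u v).symm)

/-- The Koszul formula. -/
theorem koszul_formula [FiniteDimensional ℝ E] [IsManifold I 2 M] (hg : IsSmoothMetric g)
    {X Y Z : Π x : M, TangentSpace I x} {x : M}
    (hX : MDifferentiableAt I (I.prod 𝓘(ℝ, E)) (fun y ↦ TotalSpace.mk' E y (X y)) x)
    (hY : MDifferentiableAt I (I.prod 𝓘(ℝ, E)) (fun y ↦ TotalSpace.mk' E y (Y y)) x)
    (hZ : MDifferentiableAt I (I.prod 𝓘(ℝ, E)) (fun y ↦ TotalSpace.mk' E y (Z y)) x) :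
    g x (leviCivita g Y x (X x)) (Z x) = (1 / 2 : ℝ) * (
      mvfderiv I (fun y ↦ g y (Y y) (Z y)) x (X x) + mvfderiv I (fun y ↦ g y (X y) (Z y)) x (Y x)
      - mvfderiv I (fun y ↦ g y (X y) (Y y)) x (Z x)
      + g x (VectorField.mlieBracket I X Y x) (Z x) - g x (VectorField.mlieBracket I X Z x) (Y x)
      - g x (VectorField.mlieBracket I Y Z x) (X x)) := by
  rw [mvfderiv_metric_eq hg hY hZ, mvfderiv_metric_eq hg hX hZ, mvfderiv_metric_eq hg hX hY,
    ← leviCivita_torsion_free hg hX hY, ← leviCivita_torsion_free hg hX hZ,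
    ← leviCivita_torsion_free hg hY hZ]
  simp only [map_sub, _root_.sub_apply]
  rw [hg.symm x (Y x) (leviCivita g Z x (X x)), hg.symm x (X x) (leviCivita g Z x (Y x)),
    hg.symm x (X x) (leviCivita g Y x (Z x))]
  ring

end

/-! ### Smoothness of the Levi-Civita connection. -/

section Smoothness

theorem contMDiffAt_mvfderiv_apply [IsManifold I ∞ M] {F : Type*} [NormedAddCommGroup F]
    [NormedSpace ℝ F] {f : M → F} {X : Π x : M, TangentSpace I x} {x : M}
    (hf : ContMDiffAt I 𝓘(ℝ, F) ∞ f x)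
    (hX : ContMDiffAt I (I.prod 𝓘(ℝ, E)) ∞ (fun y ↦ TotalSpace.mk' E y (X y)) x) :
    ContMDiffAt I 𝓘(ℝ, F) ∞ (fun y ↦ mvfderiv I f y (X y)) x := by
  have h1 := hf.mfderiv_const (m := ∞) (by simp)
  have h2 := ContMDiffAt.clm_apply_of_inCoordinates (E₁ := (TangentSpace I : M → Type _))
    (E₂ := (TangentSpace 𝓘(ℝ, F) : F → Type _)) (b₁ := id) (b₂ := f) (ϕ := mfderiv I 𝓘(ℝ, F) f)
    (v := X) h1 hX hf
  exact (contMDiff_snd_tangentBundle_modelSpace F 𝓘(ℝ, F)).contMDiffAt.comp x h2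

variable {g : Π x : M, TangentSpace I x →L[ℝ] TangentSpace I x →L[ℝ] ℝ}

theorem contMDiffAt_metric_apply (hg : IsSmoothMetric g) {X Y : Π x : M, TangentSpace I x} {x : M}
    (hX : ContMDiffAt I (I.prod 𝓘(ℝ, E)) ∞ (fun y ↦ TotalSpace.mk' E y (X y)) x)
    (hY : ContMDiffAt I (I.prod 𝓘(ℝ, E)) ∞ (fun y ↦ TotalSpace.mk' E y (Y y)) x) :
    ContMDiffAt I 𝓘(ℝ, ℝ) ∞ (fun y ↦ g y (X y) (Y y)) x := by
  rw [contMDiffAt_section] at hX hY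
  refine (((hg.contMDiffAt_metricCoord x).clm_apply hX).clm_apply hY).congr_of_eventuallyEq ?_
  filter_upwards [(chartAt H x).open_source.mem_nhds (mem_chart_source H x)] with y hy
  exact metric_eq_metricCoord g hy _ _

/-- `leviCivita` uses a different chart at each point, so its definition does not show smoothness in
the base point. The Koszul formula is free of charts and shows that the pairing of `∇_X Y` with any
smooth field is smooth; multiplying by the smooth inverse of the metric matrix recovers the
components of `∇_X Y`. -/
theorem IsSmoothMetric.isSmoothField_leviCivita [FiniteDimensional ℝ E] [IsManifold I ∞ M] (hg : IsSmoothMetric g)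
    {X Y : Π x : M, TangentSpace I x}
    (hX : IsSmoothField I X) (hY : IsSmoothField I Y) :
    IsSmoothField I (fun x ↦ leviCivita g Y x (X x)) := by
  have : CompleteSpace E := FiniteDimensional.complete ℝ E
  have : IsManifold I (minSmoothness ℝ 2) M := by
    rw [minSmoothness_of_isRCLikeNormedField]
    infer_instance
  -- The Lie bracket costs one derivative, which is harmless because `∞ + 1 = ∞`.
  have : IsManifold I (((⊤ : ℕ∞) : WithTop ℕ∞) + 1) M := ‹IsManifold I ∞ M›
  intro x
  rw [contMDiffAt_section]
  set u : M → E := fun y ↦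
    (trivializationAt E (TangentSpace I) x ⟨y, leviCivita g Y y (X y)⟩).2 with hu
  have hpair (e : E) : ContMDiffAt I 𝓘(ℝ, ℝ) ∞ (fun y ↦ metricCoord g x y (u y) e) x := by
    set Z : Π y : M, TangentSpace I y := FiberBundle.extend E (x := x) (e : TangentSpace I x)
    have hZ : ContMDiffAt I (I.prod 𝓘(ℝ, E)) ∞ (fun y ↦ TotalSpace.mk' E y (Z y)) x :=
      FiberBundle.contMDiffAt_extend ..
    have hXY := ContMDiffAt.mlieBracket_vectorField (m := ⊤) (n := ⊤) (hX x) (hY x) (by simp)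
    have hXZ := ContMDiffAt.mlieBracket_vectorField (m := ⊤) (n := ⊤) (hX x) hZ (by simp)
    have hYZ := ContMDiffAt.mlieBracket_vectorField (m := ⊤) (n := ⊤) (hY x) hZ (by simp)
    have h := (contMDiffAt_const (c := (1 / 2 : ℝ)) (I := I) (n := ∞) (x := x)).mul
      ((((((contMDiffAt_mvfderiv_apply (contMDiffAt_metric_apply hg (hY x) hZ) (hX x)).add
      (contMDiffAt_mvfderiv_apply (contMDiffAt_metric_apply hg (hX x) hZ) (hY x))).sub
      (contMDiffAt_mvfderiv_apply (contMDiffAt_metric_apply hg (hX x) (hY x)) hZ)).add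
      (contMDiffAt_metric_apply hg hXY hZ)).sub (contMDiffAt_metric_apply hg hXZ (hY x))).sub
      (contMDiffAt_metric_apply hg hYZ (hX x)))
    refine h.congr_of_eventuallyEq ?_
    filter_upwards [(chartAt H x).open_source.mem_nhds (mem_chart_source H x),
      (contMDiffAt_iff_contMDiffAt_nhds (n := 1) (by simp)).1
        (ContMDiffAt.of_le hZ (by simp))] with y hy hZy
    refine Eq.trans ?_ (koszul_formula hg ((hX y).mdifferentiableAt (by simp))
      ((hY y).mdifferentiableAt (by simp)) (hZy.mdifferentiableAt (by simp)))
    rw [metric_eq_metricCoord g hy]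
    congr 1
    rw [show Z y = (trivializationAt E (TangentSpace I) x).symm y
      (trivializationAt E (TangentSpace I) x ⟨x, e⟩).2 from rfl, Trivialization.apply_mk_symm _ hy]
    exact (trivializationAt_self_snd x e).symm
  -- A covector is the combination of the dual basis whose coefficients are its values on the basis,
  -- so the scalar pairings `hpair` suffice.
  have hψ : ContMDiffAt I 𝓘(ℝ, E →L[ℝ] ℝ) ∞ (fun y ↦ metricCoord g x y (u y)) x := by
    let b := Module.finBasis ℝ E
    have hb (f : E →L[ℝ] ℝ) : f = ∑ i, f (b i) • LinearMap.toContinuousLinearMap (b.coord i) := by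
      ext w
      conv_lhs => rw [← b.sum_repr w]
      simp only [map_sum, map_smul, smul_eq_mul, FunLike.coe_sum, Finset.sum_apply,
        FunLike.coe_smul, Pi.smul_apply, LinearMap.coe_toContinuousLinearMap',
        Module.Basis.coord_apply]
      exact Finset.sum_congr rfl fun i _ ↦ mul_comm _ _
    refine (ContMDiffAt.sum (t := Finset.univ) (f := fun i y ↦ metricCoord g x y (u y) (b i) •
      LinearMap.toContinuousLinearMap (b.coord i)) fun i _ ↦
        (hpair (b i)).smul contMDiffAt_const).congr_of_eventuallyEq ?_
    filter_upwards with y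
    exact hb _
  have hinv : ContMDiffAt I 𝓘(ℝ, (E →L[ℝ] ℝ) →L[ℝ] E) ∞ (fun y ↦ (metricCoord g x y).inverse) x := by
    obtain ⟨e, he⟩ := hg.isInvertible_metricCoord x
    refine ContDiffAt.comp_contMDiffAt (g := ContinuousLinearMap.inverse)
      (f := metricCoord g x) ?_ (hg.contMDiffAt_metricCoord x)
    rw [← he]
    exact contDiffAt_map_inverse e
  refine (hinv.clm_apply hψ).congr_of_eventuallyEq ?_
  filter_upwards [(chartAt H x).open_source.mem_nhds (mem_chart_source H x)] with y hy
  have hnd : (metricCoord g x y).IsInvertible := by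
    refine isInvertible_of_nondegenerate fun v hv ↦ ?_
    have h0 : (trivializationAt E (TangentSpace I) x).symmL ℝ y v = 0 := by
      refine hg.nondegenerate y _ fun w ↦ ?_
      rw [← symmL_continuousLinearMapAt_apply hy w]
      exact hv _
    rw [← Trivialization.continuousLinearMapAt_symmL (R := ℝ)
      (trivializationAt E (TangentSpace I) x) hy v, h0, map_zero]
  obtain ⟨e, he⟩ := hnd
  rw [← he, ContinuousLinearMap.inverse_equiv]
  exact (e.symm_apply_apply _).symm

end Smoothness

end LeviCivitaTheory

/-! ### Charts, Christoffel symbols and the connection along a slice of a warped product. -/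

section WarpedProduct

variable {E : Type*} [NormedAddCommGroup E] [NormedSpace ℝ E]
  {H : Type*} [TopologicalSpace H] {I : ModelWithCorners ℝ E H}
  {M : Type*} [TopologicalSpace M] [ChartedSpace H M] [IsManifold I 1 M]
  {E' : Type*} [NormedAddCommGroup E'] [NormedSpace ℝ E']
  {H' : Type*} [TopologicalSpace H'] {J : ModelWithCorners ℝ E' H'}
  {N : Type*} [TopologicalSpace N] [ChartedSpace H' N] [IsManifold J 1 N]

theorem trivializationAt_snd_eq_tangentCoordChange (x y : M) (v : TangentSpace I y) :
    (trivializationAt E (TangentSpace I) x ⟨y, v⟩).2 = tangentCoordChange I y x y v :=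
  rfl

/-- Charts of a product are products of charts, so transition maps are of the form `Prod.map` with
block diagonal derivative. Unique differentiability on the product of the model ranges identifies
that derivative with the coordinate change. -/
theorem tangentCoordChange_prod {p q : N × M} (h₁ : q.1 ∈ (chartAt H' p.1).source)
    (h₂ : q.2 ∈ (chartAt H p.2).source) :
    (tangentCoordChange (J.prod I) q p q : E' × E →L[ℝ] E' × E) =
      (tangentCoordChange J q.1 p.1 q.1).prodMap (tangentCoordChange I q.2 p.2 q.2) := by
  have d₁ := hasFDerivWithinAt_tangentCoordChange (I := J) (x := q.1) (y := p.1) (z := q.1)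
    ⟨mem_extChartAt_source q.1, by rwa [extChartAt_source]⟩
  have d₂ := hasFDerivWithinAt_tangentCoordChange (I := I) (x := q.2) (y := p.2) (z := q.2)
    ⟨mem_extChartAt_source q.2, by rwa [extChartAt_source]⟩
  have hu : UniqueDiffWithinAt ℝ (Set.range J ×ˢ Set.range I)
      (extChartAt J q.1 q.1, extChartAt I q.2 q.2) :=
    UniqueDiffWithinAt.prod J.uniqueDiffWithinAt_image I.uniqueDiffWithinAt_image
  have d : HasFDerivWithinAt (Prod.map (extChartAt J p.1 ∘ (extChartAt J q.1).symm)
     (extChartAt I p.2 ∘ (extChartAt I q.2).symm)) ((tangentCoordChange J q.1 p.1 q.1).prodMap (tangentCoordChange I q.2 p.2 q.2)) (Set.range J ×ˢ Set.range I)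
      (extChartAt J q.1 q.1, extChartAt I q.2 q.2) := by
    exact HasFDerivWithinAt.prodMap (p := (extChartAt J q.1 q.1, extChartAt I q.2 q.2))
      (d₁.mono (Set.fst_image_prod_subset _ _)) (d₂.mono (Set.snd_image_prod_subset _ _))
  have e : extChartAt (J.prod I) p ∘ (extChartAt (J.prod I) q).symm =
      Prod.map (extChartAt J p.1 ∘ (extChartAt J q.1).symm)
        (extChartAt I p.2 ∘ (extChartAt I q.2).symm) := by
    rw [extChartAt_prod, extChartAt_prod]
    rfl
  have e2 : extChartAt (J.prod I) q q = (extChartAt J q.1 q.1, extChartAt I q.2 q.2) := by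
    rw [extChartAt_prod]
    rfl
  have h3 := d.fderivWithin hu
  have hr : Set.range (J.prod I) = Set.range J ×ˢ Set.range I := Set.range_prodMap
  rw [tangentCoordChange_def, hr, ← h3]
  exact congrArg₂ (fun f z ↦ fderivWithin ℝ f (Set.range J ×ˢ Set.range I) z) e e2

theorem trivializationAt_prod_snd {p q : N × M} (h₁ : q.1 ∈ (chartAt H' p.1).source)
    (h₂ : q.2 ∈ (chartAt H p.2).source) (v : TangentSpace (J.prod I) q) :
    (trivializationAt (E' × E) (TangentSpace (J.prod I)) p ⟨q, v⟩).2 =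
      ((trivializationAt E' (TangentSpace J) p.1 ⟨q.1, Prod.fst (α := E') (β := E) v⟩).2,
        (trivializationAt E (TangentSpace I) p.2 ⟨q.2, Prod.snd (α := E') (β := E) v⟩).2) := by
  rw [trivializationAt_snd_eq_tangentCoordChange, tangentCoordChange_prod h₁ h₂]
  rfl

theorem symmL_prod {p q : N × M} (h₁ : q.1 ∈ (chartAt H' p.1).source)
    (h₂ : q.2 ∈ (chartAt H p.2).source) (u : E') (w : E) :
    @Eq (E' × E) ((trivializationAt (E' × E) (TangentSpace (J.prod I)) p).symmL ℝ q (u, w))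
      ((trivializationAt E' (TangentSpace J) p.1).symmL ℝ q.1 u,
        (trivializationAt E (TangentSpace I) p.2).symmL ℝ q.2 w) := by
  have hq : q ∈ (chartAt (ModelProd H' H) p).source := ⟨h₁, h₂⟩
  let v : TangentSpace (J.prod I) q :=
    (((trivializationAt E' (TangentSpace J) p.1).symmL ℝ q.1 u : E'),
      ((trivializationAt E (TangentSpace I) p.2).symmL ℝ q.2 w : E))
  have h : (trivializationAt (E' × E) (TangentSpace (J.prod I)) p).continuousLinearMapAt ℝ q v
      = (u, w) := by
    rw [← trivializationAt_snd_eq_continuousLinearMapAt hq, trivializationAt_prod_snd h₁ h₂]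
    refine Prod.ext ?_ ?_
    · exact (trivializationAt_snd_eq_continuousLinearMapAt h₁ _).trans
        (Trivialization.continuousLinearMapAt_symmL (R := ℝ) _ h₁ u)
    · exact (trivializationAt_snd_eq_continuousLinearMapAt h₂ _).trans
        (Trivialization.continuousLinearMapAt_symmL (R := ℝ) _ h₂ w)
  rw [← h]
  exact symmL_continuousLinearMapAt_apply hq v

variable {gN : Π y : N, TangentSpace J y →L[ℝ] TangentSpace J y →L[ℝ] ℝ} {φ : N → ℝ}
  {g : Π x : M, TangentSpace I x →L[ℝ] TangentSpace I x →L[ℝ] ℝ}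

omit [IsManifold I 1 M] [IsManifold J 1 N] in
theorem warpedMetric_apply (q : N × M) (v w : E' × E) :
    warpedMetric gN φ g q v w = gN q.1 v.1 w.1 + φ q.1 ^ 2 * g q.2 v.2 w.2 := by
  change gN q.1 (mfderiv (J.prod I) J Prod.fst q v) (mfderiv (J.prod I) J Prod.fst q w)
    + φ q.1 ^ 2 * g q.2 (mfderiv (J.prod I) I Prod.snd q v) (mfderiv (J.prod I) I Prod.snd q w) = _
  rw [mfderiv_fst, mfderiv_snd]
  rfl

theorem metricCoord_warpedMetric {p q : N × M} (h₁ : q.1 ∈ (chartAt H' p.1).source)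
    (h₂ : q.2 ∈ (chartAt H p.2).source) (v w : E' × E) :
    metricCoord (warpedMetric gN φ g) p q v w =
      metricCoord gN p.1 q.1 v.1 w.1 + φ q.1 ^ 2 * metricCoord g p.2 q.2 v.2 w.2 := by
  rw [metricCoord_apply]
  refine (congrArg₂ (fun a b : E' × E ↦ warpedMetric gN φ g q a b)
    (symmL_prod (I := I) (J := J) h₁ h₂ v.1 v.2) (symmL_prod (I := I) (J := J) h₁ h₂ w.1 w.2)).trans ?_
  exact warpedMetric_apply ..

omit [IsManifold I 1 M] [IsManifold J 1 N] in
theorem mvfderiv_comp_fst {F : Type*} [NormedAddCommGroup F] [NormedSpace ℝ F] {f : N → F}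
    {p : N × M} (hf : MDifferentiableAt J 𝓘(ℝ, F) f p.1) (u : E' × E) :
    mvfderiv (J.prod I) (fun q : N × M ↦ f q.1) p u = mvfderiv J f p.1 u.1 := by
  have h := (hf.hasMFDerivAt.comp p (hasMFDerivAt_fst (I := J) (I' := I) p)).mfderiv
  exact congrArg (fun L : E' × E →L[ℝ] F ↦ L u) h

omit [IsManifold I 1 M] [IsManifold J 1 N] in
theorem mvfderiv_comp_snd {F : Type*} [NormedAddCommGroup F] [NormedSpace ℝ F] {f : M → F}
    {p : N × M} (hf : MDifferentiableAt I 𝓘(ℝ, F) f p.2) (u : E' × E) :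
    mvfderiv (J.prod I) (fun q : N × M ↦ f q.2) p u = mvfderiv I f p.2 u.2 := by
  have h := (hf.hasMFDerivAt.comp p (hasMFDerivAt_snd (I := J) (I' := I) p)).mfderiv
  exact congrArg (fun L : E' × E →L[ℝ] F ↦ L u) h

/-- Each block of the matrix depends on the coordinates of its own factor, apart from the factor
`φ²`; differentiating that factor yields the only mixed term. -/
theorem metricCoordDeriv_warpedMetric (hgN : IsSmoothMetric gN) (hg : IsSmoothMetric g) (p : N × M)
    (hφ : MDifferentiableAt J 𝓘(ℝ, ℝ) φ p.1) {dφ : E' →L[ℝ] ℝ} (hdφ : mvfderiv J φ p.1 = dφ)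
    (u v w : E' × E) :
    metricCoordDeriv (warpedMetric gN φ g) p u v w =
      metricCoordDeriv gN p.1 u.1 v.1 w.1
        + 2 * φ p.1 * dφ u.1 * metricCoord g p.2 p.2 v.2 w.2
        + φ p.1 ^ 2 * metricCoordDeriv g p.2 u.2 v.2 w.2 := by
  set m : N × M → (E' × E) →L[ℝ] (E' × E) →L[ℝ] ℝ := fun q ↦
    ContinuousLinearMap.precomp ℝ (ContinuousLinearMap.fst ℝ E' E) ∘L
      (metricCoord gN p.1 q.1 ∘L ContinuousLinearMap.fst ℝ E' E)
    + φ q.1 ^ 2 • (ContinuousLinearMap.precomp ℝ (ContinuousLinearMap.snd ℝ E' E) ∘L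
      (metricCoord g p.2 q.2 ∘L ContinuousLinearMap.snd ℝ E' E)) with hm
  have heq : metricCoord (warpedMetric gN φ g) p =ᶠ[nhds p] m := by
    filter_upwards [(chartAt (ModelProd H' H) p).open_source.mem_nhds
      (mem_chart_source (ModelProd H' H) p)] with q hq
    refine ContinuousLinearMap.ext fun v ↦ ContinuousLinearMap.ext fun w ↦ ?_
    exact metricCoord_warpedMetric hq.1 hq.2 v w
  have hfst : MDifferentiableAt (J.prod I) J (Prod.fst : N × M → N) p := mdifferentiableAt_fst
  have hsnd : MDifferentiableAt (J.prod I) I (Prod.snd : N × M → M) p := mdifferentiableAt_snd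
  have hA : MDifferentiableAt (J.prod I) 𝓘(ℝ, E' →L[ℝ] E' →L[ℝ] ℝ)
    (fun q : N × M ↦ metricCoord gN p.1 q.1) p := (hgN.mdifferentiableAt_metricCoord p.1).comp p hfst
  have hC : MDifferentiableAt (J.prod I) 𝓘(ℝ, E →L[ℝ] E →L[ℝ] ℝ)
    (fun q : N × M ↦ metricCoord g p.2 q.2) p := (hg.mdifferentiableAt_metricCoord p.2).comp p hsnd
  have hφ' : MDifferentiableAt (J.prod I) 𝓘(ℝ, ℝ) (fun q : N × M ↦ φ q.1) p := hφ.comp p hfst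
  have hφ2 : MDifferentiableAt (J.prod I) 𝓘(ℝ, ℝ) (fun q : N × M ↦ φ q.1 ^ 2) p := by
    simp only [pow_two]
    exact hφ'.mul hφ'
  have hmd : MDifferentiableAt (J.prod I) 𝓘(ℝ, (E' × E) →L[ℝ] (E' × E) →L[ℝ] ℝ) m p :=
    (mdifferentiableAt_const.clm_comp (hA.clm_comp mdifferentiableAt_const)).add
      (hφ2.smul (mdifferentiableAt_const.clm_comp (hC.clm_comp mdifferentiableAt_const)))
  rw [metricCoordDeriv_eq, mvfderiv_congr heq]
  refine (mvfderiv_clm_apply₂_const hmd u v w).trans ?_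
  have h1 : MDifferentiableAt (J.prod I) 𝓘(ℝ, ℝ)
      (fun q : N × M ↦ metricCoord gN p.1 q.1 v.1 w.1) p :=
    (hA.clm_apply mdifferentiableAt_const).clm_apply mdifferentiableAt_const
  have h2 : MDifferentiableAt (J.prod I) 𝓘(ℝ, ℝ)
      (fun q : N × M ↦ metricCoord g p.2 q.2 v.2 w.2) p :=
    (hC.clm_apply mdifferentiableAt_const).clm_apply mdifferentiableAt_const
  have h3 : (fun q : N × M ↦ m q v w) = (fun q : N × M ↦ metricCoord gN p.1 q.1 v.1 w.1)
      + ((fun q ↦ φ q.1) * (fun q ↦ φ q.1)) * fun q ↦ metricCoord g p.2 q.2 v.2 w.2 := by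
    ext q
    change metricCoord gN p.1 q.1 v.1 w.1 + φ q.1 ^ 2 * metricCoord g p.2 q.2 v.2 w.2 =
      metricCoord gN p.1 q.1 v.1 w.1 + φ q.1 * φ q.1 * metricCoord g p.2 q.2 v.2 w.2
    ring
  rw [h3, mvfderiv_add h1 ((hφ'.mul hφ').mul h2), mvfderiv_mul (hφ'.mul hφ') h2,
    mvfderiv_mul hφ' hφ']
  have e1 : mvfderiv (J.prod I) (fun q : N × M ↦ metricCoord gN p.1 q.1 v.1 w.1) p u =
      metricCoordDeriv gN p.1 u.1 v.1 w.1 := by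
    rw [metricCoordDeriv_eq]
    refine (mvfderiv_comp_fst (f := fun y ↦ metricCoord gN p.1 y v.1 w.1)
      (((hgN.mdifferentiableAt_metricCoord p.1).clm_apply mdifferentiableAt_const).clm_apply
        mdifferentiableAt_const) u).trans ?_
    exact (mvfderiv_clm_apply₂_const (hgN.mdifferentiableAt_metricCoord p.1) u.1 v.1 w.1).symm
  have e2 : mvfderiv (J.prod I) (fun q : N × M ↦ metricCoord g p.2 q.2 v.2 w.2) p u =
      metricCoordDeriv g p.2 u.2 v.2 w.2 := by
    rw [metricCoordDeriv_eq]
    refine (mvfderiv_comp_snd (f := fun y ↦ metricCoord g p.2 y v.2 w.2)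
      (((hg.mdifferentiableAt_metricCoord p.2).clm_apply mdifferentiableAt_const).clm_apply
        mdifferentiableAt_const) u).trans ?_
    exact (mvfderiv_clm_apply₂_const (hg.mdifferentiableAt_metricCoord p.2) u.2 v.2 w.2).symm
  have e3 : mvfderiv (J.prod I) (fun q : N × M ↦ φ q.1) p u = dφ u.1 :=
    (mvfderiv_comp_fst hφ u).trans (congrArg (fun L : E' →L[ℝ] ℝ ↦ L u.1) hdφ)
  change mvfderiv (J.prod I) (fun q : N × M ↦ metricCoord gN p.1 q.1 v.1 w.1) p u
    + ((φ p.1 * φ p.1) * mvfderiv (J.prod I) (fun q : N × M ↦ metricCoord g p.2 q.2 v.2 w.2) p u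
      + metricCoord g p.2 p.2 v.2 w.2 * (φ p.1 * mvfderiv (J.prod I) (fun q : N × M ↦ φ q.1) p u
        + φ p.1 * mvfderiv (J.prod I) (fun q : N × M ↦ φ q.1) p u)) = _
  rw [e1, e2, e3]
  ring

/-- The Christoffel symbols of a warped product on a slice on which the warping function is `1`,
for a vector tangent to the slice. -/
theorem christoffel_warpedMetric [FiniteDimensional ℝ E] [FiniteDimensional ℝ E']
    (hgN : IsSmoothMetric gN) (hg : IsSmoothMetric g) (p : N × M)
    (hφ : MDifferentiableAt J 𝓘(ℝ, ℝ) φ p.1) (hp : φ p.1 = 1) {dφ : E' →L[ℝ] ℝ}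
    (hdφ : mvfderiv J φ p.1 = dφ) {G : E'} (hG : ∀ z, metricCoord gN p.1 p.1 G z = dφ z)
    (s : E' × E) (v : E) :
    christoffel (warpedMetric gN φ g) p s (0, v) =
      (-metricCoord g p.2 p.2 v s.2 • G, christoffel g p.2 s.2 v + dφ s.1 • v) := by
  have hm (v w : E' × E) : metricCoord (warpedMetric gN φ g) p p v w =
      metricCoord gN p.1 p.1 v.1 w.1 + metricCoord g p.2 p.2 v.2 w.2 := by
    rw [metricCoord_warpedMetric (mem_chart_source H' p.1) (mem_chart_source H p.2), hp, one_pow,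
      one_mul]
  have hnd (v : E' × E) (hv : ∀ w, metricCoord (warpedMetric gN φ g) p p v w = 0) : v = 0 := by
    refine Prod.ext ?_ ?_
    · refine metricCoord_nondegenerate hgN p.1 _ fun w ↦ ?_
      have h := hv (w, 0)
      rw [hm, map_zero, add_zero] at h
      exact h
    · refine metricCoord_nondegenerate hg p.2 _ fun w ↦ ?_
      have h := hv (0, w)
      rw [hm, map_zero, zero_add] at h
      exact h
  rw [← sub_eq_zero]
  refine hnd _ fun z ↦ ?_
  have h1 := metricCoord_christoffel (isInvertible_of_nondegenerate hnd) s (0, v) z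
  have h2 := metricCoord_christoffel (hg.isInvertible_metricCoord p.2) s.2 v z.2
  rw [metricCoordDeriv_warpedMetric hgN hg p hφ hdφ, metricCoordDeriv_warpedMetric hgN hg p hφ hdφ,
    metricCoordDeriv_warpedMetric hgN hg p hφ hdφ, hp] at h1
  rw [map_sub, _root_.sub_apply, hm (_ • G, _)]
  have h4 (b : E' →L[ℝ] E' →L[ℝ] ℝ) (w : E') : b 0 w = 0 := by rw [map_zero]; rfl
  have h5 (b : E →L[ℝ] E →L[ℝ] ℝ) (c : ℝ) (a v w : E) : b (a + c • v) w = b a w + c * b v w := by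
    rw [map_add, map_smul]
    rfl
  have h6 (b : E' →L[ℝ] E' →L[ℝ] ℝ) (c : ℝ) (v w : E') : b (c • v) w = c * b v w := by
    rw [map_smul]
    rfl
  have h7 (w w' : E') : metricCoordDeriv gN p.1 0 w w' = 0 := by
    rw [ContinuousLinearMap.map_zero]
    rfl
  have h8 := metricCoord_symm hg p.2 p.2 v s.2
  -- The base component of `(0, v)` is zero, so each of the three derivatives of the base metric has
  -- a zero argument. No Christoffel symbol of the base survives.
  rw [h7, h4, map_zero, map_zero] at h1
  rw [h5, h6, hG, h8]
  simp only [] at h1 ⊢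
  linarith

omit [IsManifold I 1 M] [IsManifold J 1 N] in
theorem mfderiv_sliceMap (b₀ : N) (x : M) (v : TangentSpace I x) :
    @Eq (E' × E) (mfderiv I (J.prod I) (sliceMap I M J b₀) x v) (0, v) :=
  congrArg (fun L : E →L[ℝ] E' × E ↦ L v) (mfderiv_prod_right (I := J) (I' := I) (x₀ := b₀) (y₀ := x))

/-- The section `(u, W)` of the tangent bundle of `N × M` along the slice through `b₀`. -/
def sliceSection (b₀ : N) (u : M → E') (W : Π x : M, TangentSpace I x) (x : M) :
    (sliceMap I M J b₀ *ᵖ (TangentSpace (J.prod I) : N × M → Type _)) x :=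
  ((u x, W x) : E' × E)

/-- The base point does not move along the slice. The base component is read at the centre of one
fixed chart and is unchanged; only the component tangent to `M` is transformed. -/
theorem pullback_trivializationAt_snd (b₀ : N) {x y : M} (hy : y ∈ (chartAt H x).source)
    (v : (sliceMap I M J b₀ *ᵖ (TangentSpace (J.prod I) : N × M → Type _)) y) :
    (trivializationAt (E' × E) (sliceMap I M J b₀ *ᵖ (TangentSpace (J.prod I) : N × M → Type _)) x
      ⟨y, v⟩).2 = (Prod.fst (α := E') (β := E) v,
        (trivializationAt E (TangentSpace I) x ⟨y, Prod.snd (α := E') (β := E) v⟩).2) := by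
  refine (trivializationAt_prod_snd (I := I) (J := J) (p := (b₀, x)) (q := (b₀, y))
    (mem_chart_source H' b₀) hy v).trans ?_
  exact congrArg (fun a ↦ (a, _)) (trivializationAt_self_snd (I := J) b₀ (Prod.fst (α := E') (β := E) v))

theorem pullback_symmL_self (b₀ : N) (x : M) (v : E' × E) :
    @Eq (E' × E) ((trivializationAt (E' × E)
      (sliceMap I M J b₀ *ᵖ (TangentSpace (J.prod I) : N × M → Type _)) x).symmL ℝ x v) v := by
  set t := trivializationAt (E' × E)
      (sliceMap I M J b₀ *ᵖ (TangentSpace (J.prod I) : N × M → Type _)) x with ht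
  have hx : x ∈ t.baseSet := FiberBundle.mem_baseSet_trivializationAt' x
  have h : t.continuousLinearMapAt ℝ x v = v := by
    rw [Trivialization.continuousLinearMapAt_apply, Trivialization.coe_linearMapAt_of_mem _ hx]
    refine (pullback_trivializationAt_snd b₀ (mem_chart_source H x) v).trans ?_
    exact congrArg (fun b : E ↦ (v.1, b)) (trivializationAt_self_snd (I := I) x v.2)
  exact (congrArg (t.symmL ℝ x) h.symm).trans (t.symmL_continuousLinearMapAt hx v)

theorem contMDiffAt_sliceSection_iff (b₀ : N) (u : M → E') (W : Π x : M, TangentSpace I x) (x : M) :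
    ContMDiffAt I (I.prod 𝓘(ℝ, E' × E)) ∞
      (fun y ↦ TotalSpace.mk' (E' × E) y (sliceSection (J := J) b₀ u W y)) x ↔
    ContMDiffAt I 𝓘(ℝ, E') ∞ u x ∧
      ContMDiffAt I (I.prod 𝓘(ℝ, E)) ∞ (fun y ↦ TotalSpace.mk' E y (W y)) x := by
  rw [contMDiffAt_section, contMDiffAt_section]
  refine Iff.trans (Filter.EventuallyEq.contMDiffAt_iff ?_) (contMDiffAt_prod_module_iff
    fun y ↦ (u y, (trivializationAt E (TangentSpace I) x ⟨y, W y⟩).2))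
  filter_upwards [(chartAt H x).open_source.mem_nhds (mem_chart_source H x)] with y hy
  exact pullback_trivializationAt_snd b₀ hy _

/-- The central formula. The differential of the slice sends `v` to `(0, v)`, so only the
Christoffel symbols of `christoffel_warpedMetric` enter; the coordinate derivative of `W` and the
Christoffel term of `g` recombine into `∇^g W`. The fibre of the pulled back bundle is the product
only by unfolding, hence the equality typed explicitly. -/
theorem pullbackConnection_sliceSection [FiniteDimensional ℝ E] [FiniteDimensional ℝ E']
    (hgN : IsSmoothMetric gN) (hg : IsSmoothMetric g) {b₀ : N}
    (hφ : MDifferentiableAt J 𝓘(ℝ, ℝ) φ b₀) (hb₀ : φ b₀ = 1) {dφ : E' →L[ℝ] ℝ}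
    (hdφ : mvfderiv J φ b₀ = dφ) {G : E'} (hG : ∀ z, metricCoord gN b₀ b₀ G z = dφ z)
    {u : M → E'} {W : Π x : M, TangentSpace I x} {x : M}
    (hu : MDifferentiableAt I 𝓘(ℝ, E') u x)
    (hW : MDifferentiableAt I (I.prod 𝓘(ℝ, E)) (fun y ↦ TotalSpace.mk' E y (W y)) x)
    (v : TangentSpace I x) :
    @Eq (E' × TangentSpace I x) (pullbackConnection (leviCivita (warpedMetric gN φ g))
        (sliceMap I M J b₀) (sliceSection b₀ u W) x v)
      (mvfderiv I u x v - g x v (W x) • G, leviCivita g W x v + dφ (u x) • v) := by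
  have h1 : @Eq (E' × E) (trivDeriv I (E' × E) (sliceSection (J := J) b₀ u W) x v)
      (mvfderiv I u x v,
        mvfderiv I (fun y ↦ (trivializationAt E (TangentSpace I) x ⟨y, W y⟩).2) x v) := by
    refine (pullback_symmL_self (J := J) (I := I) b₀ x _).trans ?_
    rw [mdifferentiableAt_section] at hW
    rw [← mvfderiv_prodMk hu hW]
    refine congrArg (fun L : E →L[ℝ] E' × E ↦ L v) (mvfderiv_congr ?_)
    filter_upwards [(chartAt H x).open_source.mem_nhds (mem_chart_source H x)] with y hy
    exact pullback_trivializationAt_snd b₀ hy _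
  have h2 (v : E) : @Eq (E' × E) (pullbackConnectionForm (leviCivita (warpedMetric gN φ g))
      (sliceMap I M J b₀) x (sliceSection b₀ u W x) v)
      (-metricCoord g x x v (W x) • G, christoffel g x (W x) v + dφ (u x) • v) := by
    refine Eq.trans ?_ (christoffel_warpedMetric hgN hg (b₀, x) hφ hb₀ hdφ hG (u x, W x) v)
    refine (leviCivita_extend (I := J.prod I) (g := warpedMetric gN φ g) (b₀, x)
      (sliceSection (J := J) b₀ u W x) (mfderiv I (J.prod I) (sliceMap I M J b₀) x v)).trans ?_
    exact congrArg (christoffel (warpedMetric gN φ g) (b₀, x) (sliceSection (J := J) b₀ u W x))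
      (mfderiv_sliceMap b₀ x v)
  refine (congrArg₂ (fun a b : E' × E ↦ a + b) h1 (h2 v)).trans ?_
  rw [metricCoord_self]
  refine Prod.ext ?_ ?_
  · change mvfderiv I u x v + -g x v (W x) • G = _
    rw [neg_smul, ← sub_eq_add_neg]
  · have h3 (a b c d : E) (h : d = a + b) : a + (b + c) = d + c := by rw [h, add_assoc]
    exact h3 _ _ _ _ (leviCivita_apply W x v)

end WarpedProduct

/-! ### Curvature of the connection along the slice. -/

section WarpedCurvature

variable {E : Type*} [NormedAddCommGroup E] [NormedSpace ℝ E]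
  {H : Type*} [TopologicalSpace H] {I : ModelWithCorners ℝ E H}
  {M : Type*} [TopologicalSpace M] [ChartedSpace H M] [IsManifold I ∞ M]
  {E' : Type*} [NormedAddCommGroup E'] [NormedSpace ℝ E']
  {H' : Type*} [TopologicalSpace H'] {J : ModelWithCorners ℝ E' H'}
  {N : Type*} [TopologicalSpace N] [ChartedSpace H' N] [IsManifold J 1 N]
  {gN : Π y : N, TangentSpace J y →L[ℝ] TangentSpace J y →L[ℝ] ℝ} {φ : N → ℝ}
  {g : Π x : M, TangentSpace I x →L[ℝ] TangentSpace I x →L[ℝ] ℝ}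

omit [IsManifold I ∞ M] in
theorem mvfderiv_smul_vector {F : Type*} [NormedAddCommGroup F] [NormedSpace ℝ F] {f : M → ℝ}
    {x : M} (hf : MDifferentiableAt I 𝓘(ℝ, ℝ) f x) (c : F) (v : TangentSpace I x) :
    mvfderiv I (fun y ↦ f y • c) x v = mvfderiv I f x v • c := by
  have h := mvfderiv_smul (g := fun _ : M ↦ c) hf mdifferentiableAt_const
  rw [mvfderiv_const] at h
  have h2 := congrArg (fun L ↦ L v) h
  refine h2.trans ?_
  simp

theorem IsSmoothField.smul {f : M → ℝ} {X : Π x : M, TangentSpace I x}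
    (hf : ContMDiff I 𝓘(ℝ, ℝ) ∞ f) (hX : IsSmoothField I X) : IsSmoothField I (fun x ↦ f x • X x) :=
  ContMDiff.smul_section hf hX

theorem leviCivita_add_smul_apply {X Y : Π x : M, TangentSpace I x} {f : M → ℝ} {x : M}
    (hX : MDifferentiableAt I (I.prod 𝓘(ℝ, E)) (fun y ↦ TotalSpace.mk' E y (X y)) x)
    (hY : MDifferentiableAt I (I.prod 𝓘(ℝ, E)) (fun y ↦ TotalSpace.mk' E y (Y y)) x)
    (hf : MDifferentiableAt I 𝓘(ℝ, ℝ) f x) (v : TangentSpace I x) :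
    leviCivita g (fun y ↦ X y + f y • Y y) x v =
      leviCivita g X x v + (f x • leviCivita g Y x v + mvfderiv I f x v • Y x) := by
  have hfY : MDifferentiableAt I (I.prod 𝓘(ℝ, E)) (fun y ↦ TotalSpace.mk' E y ((f • Y) y)) x :=
    hf.smul_section hY
  have h1 := (leviCivita g).isCovariantDerivativeOnUniv.add hX hfY
  have h2 := (leviCivita g).isCovariantDerivativeOnUniv.leibniz hY hf
  have h3 := h1.trans (congrArg (fun L ↦ leviCivita g X x + L) h2)
  exact congrArg (fun L ↦ L v) h3

theorem IsSmoothField.mdifferentiableAt {X : Π x : M, TangentSpace I x} (hX : IsSmoothField I X)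
    (x : M) : MDifferentiableAt I (I.prod 𝓘(ℝ, E)) (fun y ↦ TotalSpace.mk' E y (X y)) x :=
  (hX x).mdifferentiableAt (by simp)

/-- The derivative of a section of the tangent bundle along a slice, in the direction of a
vector field. -/
theorem pullbackConnection_sliceSection_field [FiniteDimensional ℝ E] [FiniteDimensional ℝ E']
    (hgN : IsSmoothMetric gN) (hg : IsSmoothMetric g) {b₀ : N}
    (hφ : MDifferentiableAt J 𝓘(ℝ, ℝ) φ b₀) (hb₀ : φ b₀ = 1) {dφ : E' →L[ℝ] ℝ}
    (hdφ : mvfderiv J φ b₀ = dφ) {G : E'} (hG : ∀ z, metricCoord gN b₀ b₀ G z = dφ z)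
    {u : M → E'} {W : Π x : M, TangentSpace I x}
    (hu : ContMDiff I 𝓘(ℝ, E') ∞ u) (hW : IsSmoothField I W) (Y : Π x : M, TangentSpace I x) :
    (fun x ↦ pullbackConnection (leviCivita (warpedMetric gN φ g))
        (sliceMap I M J b₀) (sliceSection b₀ u W) x (Y x)) =
      sliceSection b₀ (fun x ↦ mvfderiv I u x (Y x) - g x (Y x) (W x) • G)
        (fun x ↦ leviCivita g W x (Y x) + dφ (u x) • Y x) :=
  funext fun x ↦ pullbackConnection_sliceSection hgN hg hφ hb₀ hdφ hG
    ((hu x).mdifferentiableAt (by simp)) (hW.mdifferentiableAt x) (Y x)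

/-- In the base component all multiples of `G` cancel, because `∇^g` is metric and torsion free; the
curvature of the trivial connection on `u` is left. In the tangent component the terms in `dφ(u)`
and its derivatives cancel, whereas the term `-g(Y, W) G` of the first derivative is fed back
through `dφ` by the second and yields the constant curvature term. -/
theorem curvature_pullbackConnection_sliceSection [FiniteDimensional ℝ E] [FiniteDimensional ℝ E']
    (hgN : IsSmoothMetric gN) (hg : IsSmoothMetric g) {b₀ : N}
    (hφ : MDifferentiableAt J 𝓘(ℝ, ℝ) φ b₀) (hb₀ : φ b₀ = 1) {dφ : E' →L[ℝ] ℝ}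
    (hdφ : mvfderiv J φ b₀ = dφ) {G : E'} (hG : ∀ z, metricCoord gN b₀ b₀ G z = dφ z)
    {u : M → E'} {W X Y : Π x : M, TangentSpace I x}
    (hu : ContMDiff I 𝓘(ℝ, E') ∞ u) (hW : IsSmoothField I W) (hX : IsSmoothField I X)
    (hY : IsSmoothField I Y) (x : M) :
    @Eq (E' × TangentSpace I x) (curvature (pullbackConnection (leviCivita (warpedMetric gN φ g))
        (sliceMap I M J b₀)) X Y (sliceSection b₀ u W) x)
      (mvfderiv I (fun y ↦ mvfderiv I u y (Y y)) x (X x)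
          - mvfderiv I (fun y ↦ mvfderiv I u y (X y)) x (Y x)
          - mvfderiv I u x (VectorField.mlieBracket I X Y x),
        curvature (leviCivita g) X Y W x
          - dφ G • (g x (Y x) (W x) • X x - g x (X x) (W x) • Y x)) := by
  have mdY := hY.mdifferentiableAt x
  have mdX := hX.mdifferentiableAt x
  have mdW := hW.mdifferentiableAt x
  have hdu {Y : Π x : M, TangentSpace I x} (hY : IsSmoothField I Y) :
      ContMDiff I 𝓘(ℝ, E') ∞ (fun x ↦ mvfderiv I u x (Y x)) :=
    fun x ↦ contMDiffAt_mvfderiv_apply (hu x) (hY x)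
  have hgW {Y : Π x : M, TangentSpace I x} (hY : IsSmoothField I Y) :
      ContMDiff I 𝓘(ℝ, ℝ) ∞ (fun x ↦ g x (Y x) (W x)) :=
    fun x ↦ contMDiffAt_metric_apply hg (hY x) (hW x)
  have hdφu : ContMDiff I 𝓘(ℝ, ℝ) ∞ (fun x ↦ dφ (u x)) := dφ.contMDiff.comp hu
  have hLC {Y : Π x : M, TangentSpace I x} (hY : IsSmoothField I Y) :
      IsSmoothField I (fun x ↦ leviCivita g W x (Y x)) := hg.isSmoothField_leviCivita hY hW
  -- The iterated derivative for one order of `X` and `Y`, with the derivative of `g(Y, W)` already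
  -- expanded by metric compatibility; it is antisymmetrized below.
  have key {X Y : Π x : M, TangentSpace I x} (hX : IsSmoothField I X) (hY : IsSmoothField I Y) :
      @Eq (E' × TangentSpace I x) (pullbackConnection (leviCivita (warpedMetric gN φ g))
        (sliceMap I M J b₀) (fun y ↦ pullbackConnection (leviCivita (warpedMetric gN φ g))
        (sliceMap I M J b₀) (sliceSection b₀ u W) y (Y y)) x (X x))
      (mvfderiv I (fun y ↦ mvfderiv I u y (Y y)) x (X x)
        - (g x (leviCivita g Y x (X x)) (W x) + g x (Y x) (leviCivita g W x (X x))) • G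
        - (g x (X x) (leviCivita g W x (Y x)) + dφ (u x) * g x (X x) (Y x)) • G,
       leviCivita g (fun y ↦ leviCivita g W y (Y y)) x (X x)
        + (dφ (u x) • leviCivita g Y x (X x) + dφ (mvfderiv I u x (X x)) • Y x)
        + (dφ (mvfderiv I u x (Y x)) - g x (Y x) (W x) * dφ G) • X x) := by
    rw [pullbackConnection_sliceSection_field hgN hg hφ hb₀ hdφ hG hu hW Y]
    have s1 : ContMDiff I 𝓘(ℝ, E') ∞ (fun x ↦ g x (Y x) (W x) • G) := (hgW hY).smul contMDiff_const
    have s2 : IsSmoothField I (fun x ↦ leviCivita g W x (Y x) + dφ (u x) • Y x) :=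
      ContMDiff.add_section (hLC hY) (IsSmoothField.smul hdφu hY)
    refine (pullbackConnection_sliceSection hgN hg hφ hb₀ hdφ hG
      ((((hdu hY).sub s1) x).mdifferentiableAt (by simp)) (s2.mdifferentiableAt x) (X x)).trans ?_
    refine Prod.ext ?_ ?_
    · have e1 := mvfderiv_sub ((hdu hY x).mdifferentiableAt (by simp))
        ((s1 x).mdifferentiableAt (by simp))
      have e2 := mvfderiv_smul_vector ((hgW hY x).mdifferentiableAt (by simp)) G (X x)
      rw [mvfderiv_metric_eq hg (hY.mdifferentiableAt x) mdW] at e2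
      have e3 : g x (X x) (leviCivita g W x (Y x) + dφ (u x) • Y x) =
          g x (X x) (leviCivita g W x (Y x)) + dφ (u x) * g x (X x) (Y x) := by
        rw [map_add, map_smul, smul_eq_mul]
      have e4 := congrArg (fun L : TangentSpace I x →L[ℝ] E' ↦ L (X x)) e1
      exact congrArg₂ (fun a b : E' ↦ a - b)
        (e4.trans (congrArg (fun a : E' ↦ mvfderiv I (fun y ↦ mvfderiv I u y (Y y)) x (X x) - a) e2))
        (congrArg (fun a : ℝ ↦ a • G) e3)
    · have e1 := leviCivita_add_smul_apply (g := g) ((hLC hY).mdifferentiableAt x)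
        (hY.mdifferentiableAt x) ((hdφu x).mdifferentiableAt (by simp)) (X x)
      have e2 := mvfderiv_comp_fderiv (s := u) (x := x) dφ.hasFDerivAt
        ((hu x).mdifferentiableAt (by simp)) (X x)
      rw [e2] at e1
      have e3 : dφ (mvfderiv I u x (Y x) - g x (Y x) (W x) • G) =
          dφ (mvfderiv I u x (Y x)) - g x (Y x) (W x) * dφ G := by
        rw [map_sub, map_smul, smul_eq_mul]
      exact congrArg₂ (fun a b : TangentSpace I x ↦ a + b) e1
        (congrArg (fun a : ℝ ↦ a • X x) e3)
  have hbr := leviCivita_torsion_free hg mdX mdY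
  have k3 := pullbackConnection_sliceSection hgN hg hφ hb₀ hdφ hG
    ((hu x).mdifferentiableAt (by simp)) mdW (VectorField.mlieBracket I X Y x)
  have hgbr : g x (VectorField.mlieBracket I X Y x) (W x) =
      g x (leviCivita g Y x (X x)) (W x) - g x (leviCivita g X x (Y x)) (W x) := by
    rw [← hbr, map_sub, _root_.sub_apply]
  have hs := hg.symm x (X x) (Y x)
  refine (congrArg₂ (fun a b : E' × TangentSpace I x ↦ a - b)
    (congrArg₂ (fun a b : E' × TangentSpace I x ↦ a - b) (key hX hY) (key hY hX)) k3).trans ?_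
  refine Prod.ext ?_ ?_
  · have alg (p q r : E') (a b c d e f h h' k : ℝ) (hk : k = a - d) (hh : h = h') :
        (p - (a + b) • G - (c + f * h) • G) - (q - (d + c) • G - (b + f * h') • G) - (r - k • G)
        = p - q - r := by
      rw [hk, hh]
      module
    exact alg _ _ _ _ _ _ _ 0 _ _ _ _ hgbr hs
  · have alg (p q r a b v w z : TangentSpace I x) (f α β γ δ n : ℝ) (hz : a - b = z) :
        (p + (f • a + α • w) + (β - γ * n) • v) - (q + (f • b + β • v) + (α - δ * n) • w)
          - (r + f • z) = p - q - r - n • (γ • v - δ • w) := by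
      rw [← hz]
      module
    exact alg _ _ _ _ _ _ _ _ _ _ _ _ _ _ hbr

end WarpedCurvature

/-! ### Lightlike bases of a Lorentzian plane. -/

section LightlikeBasis

variable {E' : Type*} [NormedAddCommGroup E'] [NormedSpace ℝ E']

/-- The vectors `ξ`, `η` form a basis in which pairing with `η` reads off the `ξ`-coefficient and
pairing with `ξ` the `η`-coefficient, both up to sign. So the orthogonal of `ξ` in the plane is
spanned by `ξ` itself. -/
theorem eq_smul_of_lightlike {b : E' →L[ℝ] E' →L[ℝ] ℝ} (hsymm : ∀ v w, b v w = b w v)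
    (hdim : Module.finrank ℝ E' = 2) {ξ η : E'} (hξξ : b ξ ξ = 0) (hηη : b η η = 0)
    (hξη : b ξ η = -1) {u : E'} (hu : b ξ u = 0) : u = -b u η • ξ := by
  have hli : LinearIndependent ℝ ![ξ, η] := by
    refine LinearIndependent.pair_iff.2 fun s t hst ↦ ⟨?_, ?_⟩
    · have h := congrArg (b η) hst
      simp only [map_add, map_smul, hηη, hsymm η ξ, hξη, map_zero, smul_eq_mul] at h
      linarith
    · have h := congrArg (b ξ) hst
      simp only [map_add, map_smul, hξξ, hξη, map_zero, smul_eq_mul] at h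
      linarith
  have : FiniteDimensional ℝ E' := FiniteDimensional.of_finrank_pos (by rw [hdim]; norm_num)
  have hspan := hli.span_eq_top_of_card_eq_finrank' (by rw [Fintype.card_fin, hdim])
  have hmem : u ∈ Submodule.span ℝ (Set.range ![ξ, η]) := hspan ▸ Submodule.mem_top
  rw [Matrix.range_cons, Matrix.range_cons, Matrix.range_empty, Set.union_empty,
    Set.singleton_union, Submodule.mem_span_pair] at hmem
  obtain ⟨s, t, rfl⟩ := hmem
  have ht : t = 0 := by
    simp only [map_add, map_smul, hξξ, hξη, smul_eq_mul] at hu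
    linarith
  simp [ht, hξη]

/-- A nonzero vector of the kernel would be orthogonal to the timelike vector, hence spacelike, but
its square is zero. -/
theorem IsLorentzForm.nondegenerate {W : Type*} [AddCommGroup W] [Module ℝ W] [TopologicalSpace W]
    [IsTopologicalAddGroup W] [ContinuousSMul ℝ W] {b : W →L[ℝ] W →L[ℝ] ℝ} (hb : IsLorentzForm b)
    (v : W) (hv : ∀ w, b v w = 0) : v = 0 := by
  by_contra h
  obtain ⟨t, -, ht⟩ := hb.signature
  have h2 := ht v h ((hb.symm t v).trans (hv t))
  rw [hv v] at h2
  exact lt_irrefl 0 h2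

end LightlikeBasis

/-! ### The slice as data at one point, and sections of the line bundle. -/

section SliceTractor

variable {n : ℕ} {M : Type*} [TopologicalSpace M] [ChartedSpace (EuclideanSpace ℝ (Fin n)) M]
  [IsManifold (𝓡 n) ∞ M]
  {E' : Type*} [NormedAddCommGroup E'] [NormedSpace ℝ E']
  {H' : Type*} [TopologicalSpace H'] {J : ModelWithCorners ℝ E' H'}
  {N : Type*} [TopologicalSpace N] [ChartedSpace H' N] [IsManifold J 1 N]
  {gN : Π y : N, TangentSpace J y →L[ℝ] TangentSpace J y →L[ℝ] ℝ} {φ : N → ℝ}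
  {g : Π x : M, TangentSpace (𝓡 n) x →L[ℝ] TangentSpace (𝓡 n) x →L[ℝ] ℝ}

/-- The connection induced on the tangent bundle of a warped product along a slice. -/
abbrev sliceConnection (gN : Π y : N, TangentSpace J y →L[ℝ] TangentSpace J y →L[ℝ] ℝ) (φ : N → ℝ)
    (g : Π x : M, TangentSpace (𝓡 n) x →L[ℝ] TangentSpace (𝓡 n) x →L[ℝ] ℝ) (b₀ : N) :=
  inducedConnection (sliceMap (𝓡 n) M J b₀) (warpedMetric gN φ g)

/-- The metric on the tangent bundle of a warped product along a slice. -/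
abbrev sliceMetric (gN : Π y : N, TangentSpace J y →L[ℝ] TangentSpace J y →L[ℝ] ℝ) (φ : N → ℝ)
    (g : Π x : M, TangentSpace (𝓡 n) x →L[ℝ] TangentSpace (𝓡 n) x →L[ℝ] ℝ) (b₀ : N) :=
  bundleMetric (sliceMap (𝓡 n) M J b₀) (warpedMetric gN φ g)

variable (n M J) in
/-- The line subbundle spanned by the lift of a tangent vector at `b₀` along a slice. -/
abbrev sliceLine (b₀ : N) (ξ : E') (x : M) :
    Submodule ℝ ((sliceMap (𝓡 n) M J b₀ *ᵖ (TangentSpace (J.prod (𝓡 n)) : N × M → Type _)) x) :=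
  Submodule.span ℝ {sliceLift (𝓡 n) M J b₀ ξ x}

variable (gN φ g) in
/-- A slice of a warped product of a Lorentzian surface with a Riemannian manifold, through a point
of the surface at which the warping function is `1`, together with lightlike tangent vectors
`ξ`, `η` at this point, `ξ` not tangent to the level set of the warping function. The metric of the
surface, the differential and the gradient of the warping function at this point are `b`, `dφ`,
`G`. -/
structure IsLightlikeSlice (b₀ : N) (b : E' →L[ℝ] E' →L[ℝ] ℝ) (dφ : E' →L[ℝ] ℝ) (ξ η G : E') :
    Prop where
  base : IsSmoothMetric gN
  fiber : IsSmoothMetric g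
  fiber_pos : ∀ x v, v ≠ 0 → 0 < g x v v
  base_eq : metricCoord gN b₀ b₀ = b
  lorentz : IsLorentzForm b
  finrank_base : Module.finrank ℝ E' = 2
  warping : MDifferentiableAt J 𝓘(ℝ, ℝ) φ b₀
  warping_eq : φ b₀ = 1
  mvfderiv_warping : mvfderiv J φ b₀ = dφ
  gradient : ∀ z, b G z = dφ z
  left_self : b ξ ξ = 0
  right_self : b η η = 0
  left_right : b ξ η = -1
  transverse : dφ ξ ≠ 0

namespace IsLightlikeSlice

variable {b₀ : N} {b : E' →L[ℝ] E' →L[ℝ] ℝ} {dφ : E' →L[ℝ] ℝ} {ξ η G : E'}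

theorem finiteDimensional (S : IsLightlikeSlice gN φ g b₀ b dφ ξ η G) : FiniteDimensional ℝ E' :=
  FiniteDimensional.of_finrank_pos (by rw [S.finrank_base]; norm_num)

theorem left_ne_zero (S : IsLightlikeSlice gN φ g b₀ b dφ ξ η G) : ξ ≠ 0 := by
  intro h
  have h2 := S.transverse
  rw [h, map_zero] at h2
  exact h2 rfl

theorem metric_apply (S : IsLightlikeSlice gN φ g b₀ b dφ ξ η G) (x : M)
    (v w : E' × EuclideanSpace ℝ (Fin n)) :
    sliceMetric gN φ g b₀ x v w = b v.1 w.1 + g x v.2 w.2 := by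
  refine (warpedMetric_apply (b₀, x) v w).trans ?_
  have h := S.base_eq
  rw [metricCoord_self] at h
  have h1 : gN b₀ v.1 w.1 = b v.1 w.1 :=
    congrArg (fun L : E' →L[ℝ] E' →L[ℝ] ℝ ↦ L v.1 w.1) h
  have h2 : φ b₀ ^ 2 * g x v.2 w.2 = g x v.2 w.2 := by
    rw [S.warping_eq, one_pow, one_mul]
  exact congrArg₂ (fun a b : ℝ ↦ a + b) h1 h2

theorem connection_apply (S : IsLightlikeSlice gN φ g b₀ b dφ ξ η G) {u : M → E'}
    {W : Π x : M, TangentSpace (𝓡 n) x} (hu : ContMDiff (𝓡 n) 𝓘(ℝ, E') ∞ u)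
    (hW : IsSmoothField (𝓡 n) W) (x : M) (v : TangentSpace (𝓡 n) x) :
    @Eq (E' × TangentSpace (𝓡 n) x) (sliceConnection gN φ g b₀ (sliceSection b₀ u W) x v)
      (mvfderiv (𝓡 n) u x v - g x v (W x) • G, leviCivita g W x v + dφ (u x) • v) :=
  have := S.finiteDimensional
  pullbackConnection_sliceSection S.base S.fiber S.warping S.warping_eq S.mvfderiv_warping
    (by rw [S.base_eq]; exact S.gradient) ((hu x).mdifferentiableAt (by simp))
    (hW.mdifferentiableAt x) v

theorem connection_field (S : IsLightlikeSlice gN φ g b₀ b dφ ξ η G) {u : M → E'}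
    {W : Π x : M, TangentSpace (𝓡 n) x} (hu : ContMDiff (𝓡 n) 𝓘(ℝ, E') ∞ u)
    (hW : IsSmoothField (𝓡 n) W) (Y : Π x : M, TangentSpace (𝓡 n) x) :
    (fun x ↦ sliceConnection gN φ g b₀ (sliceSection b₀ u W) x (Y x)) =
      sliceSection b₀ (fun x ↦ mvfderiv (𝓡 n) u x (Y x) - g x (Y x) (W x) • G)
        (fun x ↦ leviCivita g W x (Y x) + dφ (u x) • Y x) :=
  funext fun x ↦ S.connection_apply hu hW x (Y x)

omit [IsManifold J 1 N] in
theorem isSmoothField_zero : IsSmoothField (𝓡 n) (0 : Π x : M, TangentSpace (𝓡 n) x) :=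
  contMDiff_zeroSection ℝ (TangentSpace (𝓡 n) : M → Type _)

theorem isSmoothSection_iff (u : M → E') (W : Π x : M, TangentSpace (𝓡 n) x) :
    IsSmoothSection (𝓡 n) (E' × EuclideanSpace ℝ (Fin n)) (sliceSection (J := J) b₀ u W) ↔
      ContMDiff (𝓡 n) 𝓘(ℝ, E') ∞ u ∧ IsSmoothField (𝓡 n) W :=
  ⟨fun h ↦ ⟨fun x ↦ ((contMDiffAt_sliceSection_iff b₀ u W x).1 (h x)).1,
    fun x ↦ ((contMDiffAt_sliceSection_iff b₀ u W x).1 (h x)).2⟩,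
    fun h x ↦ (contMDiffAt_sliceSection_iff b₀ u W x).2 ⟨h.1 x, h.2 x⟩⟩

theorem exists_eq_sliceSection
    {σ : Π x, (sliceMap (𝓡 n) M J b₀ *ᵖ (TangentSpace (J.prod (𝓡 n)) : N × M → Type _)) x}
    (hσ : IsSmoothSection (𝓡 n) (E' × EuclideanSpace ℝ (Fin n)) σ) :
    ∃ (u : M → E') (W : Π x : M, TangentSpace (𝓡 n) x), ContMDiff (𝓡 n) 𝓘(ℝ, E') ∞ u ∧
      IsSmoothField (𝓡 n) W ∧ σ = sliceSection b₀ u W :=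
  ⟨fun x ↦ Prod.fst (α := E') (β := EuclideanSpace ℝ (Fin n)) (σ x),
    fun x ↦ Prod.snd (α := E') (β := EuclideanSpace ℝ (Fin n)) (σ x),
    ((isSmoothSection_iff _ _).1 hσ).1, ((isSmoothSection_iff _ _).1 hσ).2, rfl⟩

omit [IsManifold J 1 N] [IsManifold (𝓡 n) ∞ M] in
theorem mem_sliceLine_iff {x : M}
    {v : (sliceMap (𝓡 n) M J b₀ *ᵖ (TangentSpace (J.prod (𝓡 n)) : N × M → Type _)) x} :
    v ∈ sliceLine n M J b₀ ξ x ↔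
      ∃ a : ℝ, @Eq (E' × EuclideanSpace ℝ (Fin n)) v (a • ξ, 0) := by
  refine Submodule.mem_span_singleton.trans (exists_congr fun a ↦ ?_)
  have h : @Eq (E' × EuclideanSpace ℝ (Fin n)) (a • sliceLift (𝓡 n) M J b₀ ξ x) (a • ξ, 0) :=
    Prod.ext rfl (smul_zero a)
  exact ⟨fun e ↦ e.symm.trans h, fun e ↦ h.trans e.symm⟩

theorem exists_eq_of_isLineSection (S : IsLightlikeSlice gN φ g b₀ b dφ ξ η G)
    {σ : Π x, (sliceMap (𝓡 n) M J b₀ *ᵖ (TangentSpace (J.prod (𝓡 n)) : N × M → Type _)) x}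
    (hσ : IsLineSection (n := n) (E' × EuclideanSpace ℝ (Fin n)) (sliceLine n M J b₀ ξ) σ) :
    ∃ a : M → ℝ, ContMDiff (𝓡 n) 𝓘(ℝ, ℝ) ∞ a ∧ σ = sliceSection b₀ (fun x ↦ a x • ξ) 0 := by
  obtain ⟨u, W, hu, -, rfl⟩ := exists_eq_sliceSection hσ.smooth
  -- Pairing with `η` extracts the coefficient of `ξ`, the sign coming from `b ξ η = -1`. It is
  -- linear in `u`, hence smooth.
  refine ⟨fun x ↦ -b (u x) η, ?_, ?_⟩
  · exact ((-b.flip η).contMDiff.comp hu)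
  · funext x
    obtain ⟨a, ha⟩ := mem_sliceLine_iff.1 (hσ.mem x)
    have h1 : u x = a • ξ := congrArg Prod.fst ha
    have h2 : W x = 0 := congrArg Prod.snd ha
    refine Prod.ext (α := E') (β := EuclideanSpace ℝ (Fin n)) ?_ h2
    change u x = -b (u x) η • ξ
    rw [h1, map_smul, _root_.smul_apply, S.left_right]
    simp

theorem isLineSection (a : M → ℝ) (ha : ContMDiff (𝓡 n) 𝓘(ℝ, ℝ) ∞ a) :
    IsLineSection (n := n) (E' × EuclideanSpace ℝ (Fin n)) (sliceLine n M J b₀ ξ)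
      (sliceSection b₀ (fun x ↦ a x • ξ) 0) where
  smooth := (isSmoothSection_iff _ _).2 ⟨ha.smul contMDiff_const, isSmoothField_zero⟩
  mem x := mem_sliceLine_iff.2 ⟨a x, rfl⟩

/-- With `W = 0` the gradient term and the Levi-Civita term vanish, and only `dφ(a ξ) v` is left in
the tangent component. This factor is why `dφ ξ ≠ 0` is needed. -/
theorem connection_line_apply (S : IsLightlikeSlice gN φ g b₀ b dφ ξ η G) {a : M → ℝ}
    (ha : ContMDiff (𝓡 n) 𝓘(ℝ, ℝ) ∞ a) (x : M) (v : TangentSpace (𝓡 n) x) :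
    @Eq (E' × TangentSpace (𝓡 n) x)
      (sliceConnection gN φ g b₀ (sliceSection b₀ (fun x ↦ a x • ξ) 0) x v)
      (mvfderiv (𝓡 n) a x v • ξ, (a x * dφ ξ) • v) := by
  refine (S.connection_apply (ha.smul contMDiff_const) isSmoothField_zero x v).trans ?_
  refine Prod.ext ?_ ?_
  · change mvfderiv (𝓡 n) (fun y ↦ a y • ξ) x v - g x v 0 • G = _
    rw [map_zero, zero_smul, sub_zero]
    exact mvfderiv_smul_vector ((ha x).mdifferentiableAt (by simp)) ξ v
  · change leviCivita g 0 x v + dφ (a x • ξ) • v = (a x * dφ ξ) • v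
    rw [CovariantDerivative.zero, map_smul, smul_eq_mul]
    exact zero_add _

theorem connection_line_field (S : IsLightlikeSlice gN φ g b₀ b dφ ξ η G) {a : M → ℝ}
    (ha : ContMDiff (𝓡 n) 𝓘(ℝ, ℝ) ∞ a) (Y : Π x : M, TangentSpace (𝓡 n) x) :
    (fun x ↦ sliceConnection gN φ g b₀ (sliceSection b₀ (fun x ↦ a x • ξ) 0) x (Y x)) =
      sliceSection b₀ (fun x ↦ mvfderiv (𝓡 n) a x (Y x) • ξ) (fun x ↦ (a x * dφ ξ) • Y x) :=
  funext fun x ↦ S.connection_line_apply ha x (Y x)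

end IsLightlikeSlice

end SliceTractor

/-! ### The tractor bundle, and compatibility of its connection with the metric. -/

section SliceTractorConnection

variable {n : ℕ} {M : Type*} [TopologicalSpace M] [ChartedSpace (EuclideanSpace ℝ (Fin n)) M]
  [IsManifold (𝓡 n) ∞ M]
  {E' : Type*} [NormedAddCommGroup E'] [NormedSpace ℝ E']
  {H' : Type*} [TopologicalSpace H'] {J : ModelWithCorners ℝ E' H'}
  {N : Type*} [TopologicalSpace N] [ChartedSpace H' N] [IsManifold J 1 N]
  {gN : Π y : N, TangentSpace J y →L[ℝ] TangentSpace J y →L[ℝ] ℝ} {φ : N → ℝ}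
  {g : Π x : M, TangentSpace (𝓡 n) x →L[ℝ] TangentSpace (𝓡 n) x →L[ℝ] ℝ}

namespace IsLightlikeSlice

variable {b₀ : N} {b : E' →L[ℝ] E' →L[ℝ] ℝ} {dφ : E' →L[ℝ] ℝ} {ξ η G : E'}

theorem isTractorBundle (S : IsLightlikeSlice gN φ g b₀ b dφ ξ η G) :
    IsTractorBundle (n := n) (E' × EuclideanSpace ℝ (Fin n)) (sliceMetric gN φ g b₀)
      (sliceLine n M J b₀ ξ) where
  rank x := by
    have := S.finiteDimensional
    change Module.finrank ℝ (E' × EuclideanSpace ℝ (Fin n)) = n + 2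
    rw [Module.finrank_prod, S.finrank_base, finrank_euclideanSpace_fin, add_comm]
  lorentz x := by
    have hm := S.metric_apply (M := M) x
    refine ⟨fun v w ↦ (hm v w).trans (Eq.trans ?_ (hm w v).symm), ?_⟩
    · exact congrArg₂ (fun a b : ℝ ↦ a + b) (S.lorentz.symm _ _) (S.fiber.symm _ _ _)
    · obtain ⟨t, ht, hpos⟩ := S.lorentz.signature
      have h0 (w : EuclideanSpace ℝ (Fin n)) : g x (0 : EuclideanSpace ℝ (Fin n)) w = 0 :=
        congrArg (fun L : EuclideanSpace ℝ (Fin n) →L[ℝ] ℝ ↦ L w) (map_zero (g x))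
      have hnn (w : EuclideanSpace ℝ (Fin n)) : 0 ≤ g x w w := by
        rcases eq_or_ne w 0 with rfl | hw
        · exact (h0 0).ge
        · exact (S.fiber_pos x w hw).le
      -- A timelike vector of the base stays timelike when padded by zero. Its orthogonal is a
      -- spacelike line of the base plus `TM`.
      refine ⟨((t, 0) : E' × EuclideanSpace ℝ (Fin n)), ?_, fun w hw hw0 ↦ ?_⟩
      · refine (hm (t, 0) (t, 0)).trans_lt ?_
        change b t t + g x (0 : EuclideanSpace ℝ (Fin n)) (0 : EuclideanSpace ℝ (Fin n)) < 0
        rw [h0, add_zero]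
        exact ht
      · let w' : E' × EuclideanSpace ℝ (Fin n) := w
        have h1 : b t w'.1 = 0 := by
          have h2 := (hm (t, 0) w').symm.trans hw0
          change b t w'.1 + g x (0 : EuclideanSpace ℝ (Fin n)) w'.2 = 0 at h2
          rwa [h0, add_zero] at h2
        refine lt_of_lt_of_eq ?_ (hm w' w').symm
        by_cases hw1 : w'.1 = 0
        · have hw2 : w'.2 ≠ 0 := fun h ↦ hw (Prod.ext (α := E') hw1 h)
          rw [hw1, map_zero]
          exact add_pos_of_nonneg_of_pos le_rfl (S.fiber_pos x _ hw2)
        · exact add_pos_of_pos_of_nonneg (hpos _ hw1 h1) (hnn _)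
  smooth σ τ hσ hτ := by
    obtain ⟨u, W, hu, hW, rfl⟩ := exists_eq_sliceSection hσ
    obtain ⟨u', W', hu', hW', rfl⟩ := exists_eq_sliceSection hτ
    have h : ContMDiff (𝓡 n) 𝓘(ℝ, ℝ) ∞ (fun x ↦ b (u x) (u' x) + g x (W x) (W' x)) := by
      refine ContMDiff.add (fun x ↦ ?_) fun x ↦ contMDiffAt_metric_apply S.fiber (hW x) (hW' x)
      exact ((contMDiffAt_const (c := b)).clm_apply (hu x)).clm_apply (hu' x)
    exact h.congr fun x ↦ S.metric_apply x (u x, W x) (u' x, W' x)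
  line x := by
    refine finrank_span_singleton (K := ℝ) fun h ↦ S.left_ne_zero ?_
    exact congrArg (Prod.fst (α := E') (β := EuclideanSpace ℝ (Fin n))) h
  line_smooth x := by
    refine ⟨_, isLineSection (fun _ ↦ 1) contMDiff_const, fun h ↦ S.left_ne_zero ?_⟩
    exact (one_smul ℝ ξ).symm.trans
      (congrArg (Prod.fst (α := E') (β := EuclideanSpace ℝ (Fin n))) h)
  lightlike x v hv := by
    obtain ⟨a, rfl⟩ := mem_sliceLine_iff.1 hv
    refine (S.metric_apply x (a • ξ, 0) (a • ξ, 0)).trans ?_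
    change b (a • ξ) (a • ξ) + g x _ (0 : TangentSpace (𝓡 n) x) = 0
    rw [map_zero, map_smul, map_smul, _root_.smul_apply, S.left_self]
    simp

theorem mem_lineOrth_iff (S : IsLightlikeSlice gN φ g b₀ b dφ ξ η G) {x : M}
    {v : (sliceMap (𝓡 n) M J b₀ *ᵖ (TangentSpace (J.prod (𝓡 n)) : N × M → Type _)) x} :
    v ∈ lineOrth (sliceMetric gN φ g b₀) (sliceLine n M J b₀ ξ) x ↔
      b ξ (Prod.fst (α := E') (β := EuclideanSpace ℝ (Fin n)) v) = 0 := by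
  have h (a : ℝ) (v : E' × EuclideanSpace ℝ (Fin n)) :
      sliceMetric gN φ g b₀ x ((a • ξ, 0) : E' × EuclideanSpace ℝ (Fin n)) v = a * b ξ v.1 := by
    refine (S.metric_apply x (a • ξ, 0) v).trans ?_
    have h0 : g x (0 : EuclideanSpace ℝ (Fin n)) v.2 = 0 :=
      congrArg (fun L : EuclideanSpace ℝ (Fin n) →L[ℝ] ℝ ↦ L v.2) (map_zero (g x))
    refine (congrArg (fun c : ℝ ↦ b (a • ξ) v.1 + c) h0).trans ?_
    rw [add_zero, map_smul, _root_.smul_apply, smul_eq_mul]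
  refine ⟨fun hv ↦ ?_, fun hv w hw ↦ ?_⟩
  · have h1 := (h 1 v).symm.trans (hv _ (mem_sliceLine_iff.2 ⟨1, rfl⟩))
    rwa [one_mul] at h1
  · obtain ⟨a, rfl⟩ := mem_sliceLine_iff.1 hw
    refine (h a v).trans ?_
    exact (congrArg (fun c : ℝ ↦ a * c) hv).trans (mul_zero a)

theorem connection_isSmoothSection (S : IsLightlikeSlice gN φ g b₀ b dφ ξ η G)
    {X : Π x : M, TangentSpace (𝓡 n) x}
    {σ : Π x, (sliceMap (𝓡 n) M J b₀ *ᵖ (TangentSpace (J.prod (𝓡 n)) : N × M → Type _)) x}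
    (hX : IsSmoothField (𝓡 n) X)
    (hσ : IsSmoothSection (𝓡 n) (E' × EuclideanSpace ℝ (Fin n)) σ) :
    IsSmoothSection (𝓡 n) (E' × EuclideanSpace ℝ (Fin n))
      (fun x ↦ sliceConnection gN φ g b₀ σ x (X x)) := by
  obtain ⟨u, W, hu, hW, rfl⟩ := exists_eq_sliceSection hσ
  rw [S.connection_field hu hW X]
  refine (isSmoothSection_iff _ _).2 ⟨?_, ?_⟩
  · refine ContMDiff.sub (fun x ↦ contMDiffAt_mvfderiv_apply (hu x) (hX x)) ?_
    exact ContMDiff.smul (fun x ↦ contMDiffAt_metric_apply S.fiber (hX x) (hW x)) contMDiff_const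
  · exact ContMDiff.add_section (S.fiber.isSmoothField_leviCivita hX hW)
      (IsSmoothField.smul (dφ.contMDiff.comp hu) hX)

/-- The trivial connection preserves the constant form `b` and `∇^g` preserves `g`. The two
correction terms form a skew endomorphism: since `b(G, u) = dφ(u)`, the term `-g(v, W) G` and the
term `dφ(u) v` are negatives of each other's adjoints. -/
theorem connection_metric (S : IsLightlikeSlice gN φ g b₀ b dφ ξ η G)
    {σ τ : Π x, (sliceMap (𝓡 n) M J b₀ *ᵖ (TangentSpace (J.prod (𝓡 n)) : N × M → Type _)) x}
    (hσ : IsSmoothSection (𝓡 n) (E' × EuclideanSpace ℝ (Fin n)) σ)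
    (hτ : IsSmoothSection (𝓡 n) (E' × EuclideanSpace ℝ (Fin n)) τ)
    (x : M) (v : TangentSpace (𝓡 n) x) :
    mvfderiv (𝓡 n) (fun y ↦ sliceMetric gN φ g b₀ y (σ y) (τ y)) x v =
      sliceMetric gN φ g b₀ x (sliceConnection gN φ g b₀ σ x v) (τ x)
        + sliceMetric gN φ g b₀ x (σ x) (sliceConnection gN φ g b₀ τ x v) := by
  obtain ⟨u, W, hu, hW, rfl⟩ := exists_eq_sliceSection hσ
  obtain ⟨u', W', hu', hW', rfl⟩ := exists_eq_sliceSection hτ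
  have mu := (hu x).mdifferentiableAt (by simp)
  have mu' := (hu' x).mdifferentiableAt (by simp)
  have e1 : (fun y ↦ sliceMetric gN φ g b₀ y (sliceSection b₀ u W y) (sliceSection b₀ u' W' y)) =
      (fun y ↦ b (u y) (u' y)) + fun y ↦ g y (W y) (W' y) :=
    funext fun y ↦ S.metric_apply y (u y, W y) (u' y, W' y)
  have e2 : mvfderiv (𝓡 n) (fun y ↦ b (u y) (u' y)) x v =
      b (mvfderiv (𝓡 n) u x v) (u' x) + b (u x) (mvfderiv (𝓡 n) u' x v) := by
    rw [mvfderiv_clm_apply₂ (b := fun _ ↦ b) mdifferentiableAt_const mu mu', mvfderiv_const]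
    change (0 : ℝ) + _ + _ = _
    rw [zero_add]
  have e3 := mvfderiv_add (g := fun y ↦ b (u y) (u' y)) (g' := fun y ↦ g y (W y) (W' y))
    ((mdifferentiableAt_const.clm_apply mu).clm_apply mu')
    ((contMDiffAt_metric_apply S.fiber (hW x) (hW' x)).mdifferentiableAt (by simp))
  have e4 := mvfderiv_metric_eq S.fiber (hW.mdifferentiableAt x) (hW'.mdifferentiableAt x) v
  have e5 : mvfderiv (𝓡 n) (fun y ↦ sliceMetric gN φ g b₀ y (sliceSection b₀ u W y)
      (sliceSection b₀ u' W' y)) x v = _ :=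
    (congrArg (fun f ↦ mvfderiv (𝓡 n) f x v) e1).trans
      ((congrArg (fun L ↦ L v) e3).trans (congrArg₂ (fun a b : ℝ ↦ a + b) e2 e4))
  have c1 := S.connection_apply hu hW x v
  have c2 := S.connection_apply hu' hW' x v
  refine e5.trans (Eq.symm ?_)
  refine (congrArg₂ (fun a b : ℝ ↦ a + b)
    ((congrArg (fun a : E' × EuclideanSpace ℝ (Fin n) ↦
      sliceMetric gN φ g b₀ x a (sliceSection b₀ u' W' x)) c1).trans
        (S.metric_apply x _ (u' x, W' x)))
    ((congrArg (fun a : E' × EuclideanSpace ℝ (Fin n) ↦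
      sliceMetric gN φ g b₀ x (sliceSection b₀ u W x) a) c2).trans
        (S.metric_apply x (u x, W x) _))).trans ?_
  have f1 (p q : E') (r : ℝ) : b (p - r • G) q = b p q - r * dφ q := by
    rw [map_sub, map_smul, _root_.sub_apply, _root_.smul_apply, S.gradient, smul_eq_mul]
  have f2 (p q : E') (r : ℝ) : b p (q - r • G) = b p q - r * dφ p := by
    rw [S.lorentz.symm, f1, S.lorentz.symm]
  have f3 (p q w : TangentSpace (𝓡 n) x) (r : ℝ) : g x (p + r • q) w = g x p w + r * g x q w := by
    rw [map_add, map_smul, _root_.add_apply, _root_.smul_apply, smul_eq_mul]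
  have f4 (p q w : TangentSpace (𝓡 n) x) (r : ℝ) : g x w (p + r • q) = g x w p + r * g x q w := by
    rw [S.fiber.symm, f3, S.fiber.symm x p]
  refine (congrArg₂ (fun a b : ℝ ↦ a + b)
    (congrArg₂ (fun a b : ℝ ↦ a + b) (f1 _ _ _) (f3 _ _ _ _))
    (congrArg₂ (fun a b : ℝ ↦ a + b) (f2 _ _ _) (f4 _ _ _ _))).trans ?_
  ring

end IsLightlikeSlice

end SliceTractorConnection

/-! ### The map `β` and the conformal class. -/

section SliceStandard

variable {n : ℕ} {M : Type*} [TopologicalSpace M] [ChartedSpace (EuclideanSpace ℝ (Fin n)) M]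
  [IsManifold (𝓡 n) ∞ M]
  {E' : Type*} [NormedAddCommGroup E'] [NormedSpace ℝ E']
  {H' : Type*} [TopologicalSpace H'] {J : ModelWithCorners ℝ E' H'}
  {N : Type*} [TopologicalSpace N] [ChartedSpace H' N] [IsManifold J 1 N]
  {gN : Π y : N, TangentSpace J y →L[ℝ] TangentSpace J y →L[ℝ] ℝ} {φ : N → ℝ}
  {g : Π x : M, TangentSpace (𝓡 n) x →L[ℝ] TangentSpace (𝓡 n) x →L[ℝ] ℝ}

namespace IsLightlikeSlice

variable {b₀ : N} {b : E' →L[ℝ] E' →L[ℝ] ℝ} {dφ : E' →L[ℝ] ℝ} {ξ η G : E'}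

/-- The component along `ξ` of a vector of the line subbundle, `η` being the second lightlike
vector. -/
def lineCoord (b₀ : N) (b : E' →L[ℝ] E' →L[ℝ] ℝ) (ξ η : E') (x : M) :
    sliceLine n M J b₀ ξ x →ₗ[ℝ] ℝ where
  toFun s := -b (Prod.fst (α := E') (β := EuclideanSpace ℝ (Fin n)) s.1) η
  map_add' s t := by
    have h (p q : E') : -b (p + q) η = -b p η + -b q η := by
      rw [map_add, _root_.add_apply, neg_add]
    exact h _ _
  map_smul' a s := by
    have h (p : E') : -b (a • p) η = a * -b p η := by
      rw [map_smul, _root_.smul_apply, smul_eq_mul, mul_neg]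
    exact h _

theorem inr_mem_lineOrth (S : IsLightlikeSlice gN φ g b₀ b dφ ξ η G) (x : M)
    (v : EuclideanSpace ℝ (Fin n)) : ((0, v) : E' × EuclideanSpace ℝ (Fin n)) ∈
      lineOrth (sliceMetric gN φ g b₀) (sliceLine n M J b₀ ξ) x :=
  S.mem_lineOrth_iff.2 (map_zero (b ξ))

/-- The class modulo the line subbundle of a vector tangent to the slice. -/
def tangentClass (S : IsLightlikeSlice gN φ g b₀ b dφ ξ η G) (x : M) :
    TangentSpace (𝓡 n) x →ₗ[ℝ] (lineOrth (sliceMetric gN φ g b₀) (sliceLine n M J b₀ ξ) x ⧸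
      (sliceLine n M J b₀ ξ x).submoduleOf
        (lineOrth (sliceMetric gN φ g b₀) (sliceLine n M J b₀ ξ) x)) where
  toFun v := Submodule.Quotient.mk ⟨((0, v) : E' × EuclideanSpace ℝ (Fin n)), S.inr_mem_lineOrth x v⟩
  map_add' _ _ := congrArg Submodule.Quotient.mk (Subtype.ext
    (Prod.ext (α := E') (β := EuclideanSpace ℝ (Fin n)) (add_zero (0 : E')).symm rfl))
  map_smul' a _ := congrArg Submodule.Quotient.mk (Subtype.ext
    (Prod.ext (α := E') (β := EuclideanSpace ℝ (Fin n)) (smul_zero (A := E') a).symm rfl))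

/-- The base part of a vector orthogonal to `ξ` is a multiple of `ξ`, so it dies in the quotient and
only the part tangent to `M` counts. -/
theorem mk_eq_tangentClass (S : IsLightlikeSlice gN φ g b₀ b dφ ξ η G) {x : M}
    (p : lineOrth (sliceMetric gN φ g b₀) (sliceLine n M J b₀ ξ) x) :
    Submodule.Quotient.mk p =
      S.tangentClass x (Prod.snd (α := E') (β := EuclideanSpace ℝ (Fin n)) p.1) := by
  refine (Submodule.Quotient.eq _).2 ?_
  refine mem_sliceLine_iff.2 ⟨-b (Prod.fst (α := E') (β := EuclideanSpace ℝ (Fin n)) p.1) η, ?_⟩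
  have h := eq_smul_of_lightlike S.lorentz.symm S.finrank_base S.left_self S.right_self
    S.left_right (S.mem_lineOrth_iff.1 p.2)
  exact Prod.ext ((sub_zero _).trans h) (sub_self _)

theorem tangentClass_injective (S : IsLightlikeSlice gN φ g b₀ b dφ ξ η G) (x : M) :
    Function.Injective (S.tangentClass x) := by
  refine (injective_iff_map_eq_zero (S.tangentClass x)).2 fun v hv ↦ ?_
  have h := (Submodule.Quotient.mk_eq_zero _).1 hv
  obtain ⟨a, ha⟩ := mem_sliceLine_iff.1 h
  exact congrArg Prod.snd ha

theorem lineCoord_sliceSection (S : IsLightlikeSlice gN φ g b₀ b dφ ξ η G) (a : ℝ) (x : M)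
    (h : ((a • ξ, 0) : E' × EuclideanSpace ℝ (Fin n)) ∈ sliceLine n M J b₀ ξ x) :
    lineCoord b₀ b ξ η x ⟨((a • ξ, 0) : E' × EuclideanSpace ℝ (Fin n)), h⟩ = a := by
  change -b (a • ξ) η = a
  rw [map_smul, _root_.smul_apply, S.left_right]
  simp

/-- The map `β` of the tractor connection along the slice. -/
def sliceBeta (S : IsLightlikeSlice gN φ g b₀ b dφ ξ η G) (x : M) :
    TangentSpace (𝓡 n) x →ₗ[ℝ] (sliceLine n M J b₀ ξ x →ₗ[ℝ]
      (lineOrth (sliceMetric gN φ g b₀) (sliceLine n M J b₀ ξ) x ⧸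
      (sliceLine n M J b₀ ξ x).submoduleOf
        (lineOrth (sliceMetric gN φ g b₀) (sliceLine n M J b₀ ξ) x))) :=
  (LinearMap.lsmul ℝ _ ∘ₗ (dφ ξ • lineCoord b₀ b ξ η x)).flip ∘ₗ S.tangentClass x

variable (n M J) in
/-- The lift of `ξ`, as an element of the line subbundle that it spans. -/
def lineGenerator (b₀ : N) (ξ : E') (x : M) : sliceLine n M J b₀ ξ x :=
  ⟨((ξ, 0) : E' × EuclideanSpace ℝ (Fin n)), mem_sliceLine_iff.2 ⟨1, by rw [one_smul]⟩⟩

theorem lineCoord_lineGenerator (S : IsLightlikeSlice gN φ g b₀ b dφ ξ η G) (x : M) :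
    lineCoord b₀ b ξ η x (lineGenerator n M J b₀ ξ x) = 1 := by
  change -b ξ η = 1
  rw [S.left_right, neg_neg]

theorem eq_lineCoord_smul (S : IsLightlikeSlice gN φ g b₀ b dφ ξ η G) {x : M}
    (s : sliceLine n M J b₀ ξ x) :
    s = lineCoord b₀ b ξ η x s • lineGenerator n M J b₀ ξ x := by
  obtain ⟨s, hs⟩ := s
  obtain ⟨a, rfl⟩ := mem_sliceLine_iff.1 hs
  rw [S.lineCoord_sliceSection]
  refine Subtype.ext (Prod.ext (α := E') (β := EuclideanSpace ℝ (Fin n)) rfl ?_)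
  exact (smul_zero (A := EuclideanSpace ℝ (Fin n)) a).symm

theorem sliceBeta_lineGenerator (S : IsLightlikeSlice gN φ g b₀ b dφ ξ η G) (x : M)
    (v : TangentSpace (𝓡 n) x) :
    S.sliceBeta x v (lineGenerator n M J b₀ ξ x) = S.tangentClass x (dφ ξ • v) :=
  (congrArg (fun r : ℝ ↦ (dφ ξ * r) • S.tangentClass x v) (S.lineCoord_lineGenerator x)).trans
    ((congrArg (fun r : ℝ ↦ r • S.tangentClass x v) (mul_one _)).trans
      ((S.tangentClass x).map_smul _ _).symm)

theorem sliceBeta_injective (S : IsLightlikeSlice gN φ g b₀ b dφ ξ η G) (x : M) :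
    Function.Injective (S.sliceBeta x) := by
  refine (injective_iff_map_eq_zero (S.sliceBeta x)).2 fun v hv ↦ ?_
  have h2 := (S.sliceBeta_lineGenerator x v).symm.trans
    (congrArg (fun L ↦ L (lineGenerator n M J b₀ ξ x)) hv)
  have h3 : dφ ξ • v = 0 := S.tangentClass_injective x (h2.trans (map_zero _).symm)
  exact (smul_eq_zero.1 h3).resolve_left S.transverse

/-- A linear map on a line is determined by its value on the generator, so it is enough to match
that value. -/
theorem sliceBeta_surjective (S : IsLightlikeSlice gN φ g b₀ b dφ ξ η G) (x : M) :
    Function.Surjective (S.sliceBeta x) := by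
  intro ψ
  obtain ⟨p, hp⟩ := Submodule.Quotient.mk_surjective _ (ψ (lineGenerator n M J b₀ ξ x))
  let w : TangentSpace (𝓡 n) x := Prod.snd (α := E') (β := EuclideanSpace ℝ (Fin n)) p.1
  have hcw : dφ ξ • (dφ ξ)⁻¹ • w = w := by
    rw [smul_smul, mul_inv_cancel₀ S.transverse, one_smul]
  have hw := (S.sliceBeta_lineGenerator x ((dφ ξ)⁻¹ • w)).trans
    ((congrArg (S.tangentClass x) hcw).trans ((S.mk_eq_tangentClass p).symm.trans hp))
  have h (L : sliceLine n M J b₀ ξ x →ₗ[ℝ]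
      (lineOrth (sliceMetric gN φ g b₀) (sliceLine n M J b₀ ξ) x ⧸
      (sliceLine n M J b₀ ξ x).submoduleOf
        (lineOrth (sliceMetric gN φ g b₀) (sliceLine n M J b₀ ξ) x))) (s) :
      L s = lineCoord b₀ b ξ η x s • L (lineGenerator n M J b₀ ξ x) :=
    (congrArg L (S.eq_lineCoord_smul s)).trans (L.map_smul _ _)
  -- At the generator `β` multiplies tangent vectors by `dφ ξ`, so the preimage is the tangent part
  -- of the prescribed value divided by `dφ ξ`.
  refine ⟨(dφ ξ)⁻¹ • w, LinearMap.ext fun s ↦ ?_⟩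
  exact (h _ s).trans ((congrArg (fun p ↦ lineCoord b₀ b ξ η x s • p) hw).trans (h ψ s).symm)

theorem connection_line_mem_lineOrth (S : IsLightlikeSlice gN φ g b₀ b dφ ξ η G) {a : M → ℝ}
    (ha : ContMDiff (𝓡 n) 𝓘(ℝ, ℝ) ∞ a) (x : M) (v : TangentSpace (𝓡 n) x) :
    sliceConnection gN φ g b₀ (sliceSection b₀ (fun x ↦ a x • ξ) 0) x v ∈
      lineOrth (sliceMetric gN φ g b₀) (sliceLine n M J b₀ ξ) x := by
  refine S.mem_lineOrth_iff.2 ((congrArg (fun p : E' × EuclideanSpace ℝ (Fin n) ↦ b ξ p.1)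
    (S.connection_line_apply ha x v)).trans ?_)
  change b ξ (mvfderiv (𝓡 n) a x v • ξ) = 0
  rw [map_smul, S.left_self, smul_zero]

/-- The derivative of the coefficient `a` appears only along `ξ` and disappears in the quotient, so
`β` depends on the value of the section alone. -/
theorem sliceBeta_eq_mk (S : IsLightlikeSlice gN φ g b₀ b dφ ξ η G) {a : M → ℝ}
    (ha : ContMDiff (𝓡 n) 𝓘(ℝ, ℝ) ∞ a) (x : M) (v : TangentSpace (𝓡 n) x)
    (h : sliceSection (J := J) b₀ (fun x ↦ a x • ξ) 0 x ∈ sliceLine n M J b₀ ξ x) :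
    S.sliceBeta x v ⟨sliceSection b₀ (fun x ↦ a x • ξ) 0 x, h⟩ =
      Submodule.Quotient.mk ⟨_, S.connection_line_mem_lineOrth ha x v⟩ := by
  refine Eq.trans ?_ (S.mk_eq_tangentClass ⟨_, S.connection_line_mem_lineOrth ha x v⟩).symm
  refine Eq.trans (b := S.tangentClass x ((a x * dφ ξ) • v)) ?_
    (congrArg (fun p : E' × EuclideanSpace ℝ (Fin n) ↦ S.tangentClass x p.2)
      (S.connection_line_apply ha x v)).symm
  refine Eq.trans ?_ ((S.tangentClass x).map_smul _ _).symm
  refine (congrArg (fun r : ℝ ↦ (dφ ξ * r) • S.tangentClass x v)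
    (S.lineCoord_sliceSection (a x) x h)).trans ?_
  exact congrArg (fun r : ℝ ↦ r • S.tangentClass x v) (mul_comm _ _)

/-- The isomorphism `β` of the tractor connection along the slice. -/
def sliceBetaEquiv (S : IsLightlikeSlice gN φ g b₀ b dφ ξ η G) (x : M) :
    TangentSpace (𝓡 n) x ≃ₗ[ℝ] (sliceLine n M J b₀ ξ x →ₗ[ℝ]
      (lineOrth (sliceMetric gN φ g b₀) (sliceLine n M J b₀ ξ) x ⧸
      (sliceLine n M J b₀ ξ x).submoduleOf
        (lineOrth (sliceMetric gN φ g b₀) (sliceLine n M J b₀ ξ) x))) :=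
  LinearEquiv.ofBijective (S.sliceBeta x) ⟨S.sliceBeta_injective x, S.sliceBeta_surjective x⟩

theorem sliceBetaEquiv_eq_mk (S : IsLightlikeSlice gN φ g b₀ b dφ ξ η G)
    (σ : Π x, (sliceMap (𝓡 n) M J b₀ *ᵖ (TangentSpace (J.prod (𝓡 n)) : N × M → Type _)) x)
    (hσ : IsLineSection (n := n) (E' × EuclideanSpace ℝ (Fin n)) (sliceLine n M J b₀ ξ) σ)
    (x : M) (v : TangentSpace (𝓡 n) x) :
    ∃ h : sliceConnection gN φ g b₀ σ x v ∈
        lineOrth (sliceMetric gN φ g b₀) (sliceLine n M J b₀ ξ) x,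
      S.sliceBetaEquiv x v ⟨σ x, hσ.mem x⟩ =
        Submodule.Quotient.mk ⟨sliceConnection gN φ g b₀ σ x v, h⟩ := by
  obtain ⟨a, ha, rfl⟩ := S.exists_eq_of_isLineSection hσ
  exact ⟨S.connection_line_mem_lineOrth ha x v, S.sliceBeta_eq_mk ha x v (hσ.mem x)⟩

theorem isTractorConnection (S : IsLightlikeSlice gN φ g b₀ b dφ ξ η G) :
    IsTractorConnection (M := M) (sliceMetric gN φ g b₀) (sliceLine n M J b₀ ξ)
      (sliceConnection gN φ g b₀) where
  smooth _ _ hX hσ := S.connection_isSmoothSection hX hσ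
  metric _ _ hσ hτ x v := S.connection_metric hσ hτ x v
  beta := ⟨S.sliceBetaEquiv, S.sliceBetaEquiv_eq_mk⟩

/-- Since `ξ` is lightlike, the `ξ`-components pair to zero: the metric descends to the quotient by
the line bundle. As `k` is arbitrary, these components never have to be computed. -/
theorem metric_connection_line (S : IsLightlikeSlice gN φ g b₀ b dφ ξ η G) {a : M → ℝ}
    (ha : ContMDiff (𝓡 n) 𝓘(ℝ, ℝ) ∞ a) (x : M) (v : TangentSpace (𝓡 n) x)
    (k : ℝ) (w : TangentSpace (𝓡 n) x) :
    sliceMetric gN φ g b₀ x ((k • ξ, w) : E' × EuclideanSpace ℝ (Fin n))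
      (sliceConnection gN φ g b₀ (sliceSection b₀ (fun x ↦ a x • ξ) 0) x v) =
      a x * dφ ξ * g x w v := by
  refine (congrArg (fun p : E' × EuclideanSpace ℝ (Fin n) ↦
    sliceMetric gN φ g b₀ x ((k • ξ, w) : E' × EuclideanSpace ℝ (Fin n)) p)
    (S.connection_line_apply ha x v)).trans ?_
  refine (S.metric_apply x (k • ξ, w) (mvfderiv (𝓡 n) a x v • ξ, (a x * dφ ξ) • v)).trans ?_
  have h1 (c : ℝ) : b (k • ξ) (c • ξ) = 0 := by
    rw [map_smul, map_smul, _root_.smul_apply, S.left_self, smul_zero, smul_zero]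
  have h2 (c : ℝ) : g x w (c • v) = c * g x w v := by rw [map_smul, smul_eq_mul]
  exact (congrArg₂ (fun a b : ℝ ↦ a + b) (h1 _) (h2 _)).trans (zero_add _)

theorem isStandardTractor (S : IsLightlikeSlice gN φ g b₀ b dφ ξ η G) :
    IsStandardTractor g (sliceMetric gN φ g b₀) (sliceLine n M J b₀ ξ)
      (sliceConnection gN φ g b₀) where
  bundle := S.isTractorBundle
  connection := S.isTractorConnection
  conformal σ hσ := by
    obtain ⟨a, ha, rfl⟩ := S.exists_eq_of_isLineSection hσ
    -- The tangent part of `∇_v σ` is `(a dφ(ξ)) v`, and `h^σ` is quadratic in it.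
    refine ⟨fun x ↦ (a x * dφ ξ) ^ 2, (ha.mul contMDiff_const).pow 2, fun x hx ↦ ?_,
      fun x v w ↦ ?_⟩
    · have h : a x ≠ 0 := by
        intro h
        refine hx (Prod.ext (α := E') (β := EuclideanSpace ℝ (Fin n)) ?_ rfl)
        exact (congrArg (fun r : ℝ ↦ r • ξ) h).trans (zero_smul ℝ ξ)
      have h2 := mul_ne_zero h S.transverse
      positivity
    · refine (congrArg (fun p : E' × EuclideanSpace ℝ (Fin n) ↦ sliceMetric gN φ g b₀ x p _)
        (S.connection_line_apply ha x v)).trans ?_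
      refine (S.metric_connection_line ha x w _ _).trans ?_
      rw [map_smul, _root_.smul_apply, smul_eq_mul]
      ring

end IsLightlikeSlice

end SliceStandard

/-! ### Traces over orthonormal frames. -/

section Traces

/-- As many orthonormal vectors as the dimension form a basis, and `b v (e i)` is the coefficient of
`v` along `e i`. -/
theorem sum_orthonormal {F : Type*} [NormedAddCommGroup F] [NormedSpace ℝ F] [FiniteDimensional ℝ F]
    {n : ℕ} (hF : Module.finrank ℝ F = n) {b : F →L[ℝ] F →L[ℝ] ℝ} {e : Fin n → F}
    (he : ∀ i j, b (e i) (e j) = if i = j then 1 else 0) (v w : F) :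
    ∑ i, b (e i) w * b v (e i) = b v w := by
  have hsum (c : Fin n → ℝ) (j : Fin n) : b (∑ i, c i • e i) (e j) = c j := by
    simp [he]
  have hli : LinearIndependent ℝ e := by
    refine Fintype.linearIndependent_iff.2 fun c hc j ↦ ?_
    rw [← hsum c j, hc, map_zero]
    rfl
  have hspan := hli.span_eq_top_of_card_eq_finrank' (by rw [Fintype.card_fin, hF])
  have hmem : v ∈ Submodule.span ℝ (Set.range e) := hspan ▸ Submodule.mem_top
  obtain ⟨c, rfl⟩ := (Submodule.mem_span_range_iff_exists_fun ℝ).1 hmem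
  simp only [hsum]
  simp [mul_comm]

end Traces

/-! ### Curvature at the zero section and under constant rescaling. -/

section WarpedNormal

variable {E : Type*} [NormedAddCommGroup E] [NormedSpace ℝ E] [FiniteDimensional ℝ E]
  {H : Type*} [TopologicalSpace H] {I : ModelWithCorners ℝ E H}
  {M : Type*} [TopologicalSpace M] [ChartedSpace H M] [IsManifold I ∞ M]
  {g : Π x : M, TangentSpace I x →L[ℝ] TangentSpace I x →L[ℝ] ℝ}

omit [FiniteDimensional ℝ E] in
theorem curvature_leviCivita_zero (X Y : Π x : M, TangentSpace I x) (x : M) :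
    curvature (leviCivita g) X Y 0 x = 0 := by
  have h (Y : Π x : M, TangentSpace I x) :
      (fun y ↦ leviCivita g 0 y (Y y)) = (0 : Π x : M, TangentSpace I x) := by
    funext y
    rw [CovariantDerivative.zero]
    rfl
  have h0 (v : TangentSpace I x) : leviCivita g 0 x v = 0 := by
    rw [CovariantDerivative.zero]
    rfl
  rw [curvature, h, h, h0, h0, h0, sub_zero, sub_zero]

/-- Serves to turn a frame orthonormal for `h^σ` into one orthonormal for `g`. Frames need be
orthonormal at one point only, so a constant factor is enough. -/
theorem curvature_leviCivita_const_smul (hg : IsSmoothMetric g) (k : ℝ)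
    {X Y Z : Π x : M, TangentSpace I x} (hX : IsSmoothField I X) (hZ : IsSmoothField I Z) (x : M) :
    curvature (leviCivita g) (k • X) Y Z x = k • curvature (leviCivita g) X Y Z x := by
  have h1 : (fun y ↦ leviCivita g Z y ((k • X) y)) = k • fun y ↦ leviCivita g Z y (X y) :=
    funext fun y ↦ (leviCivita g Z y).map_smul k (X y)
  have h2 := (leviCivita g).isCovariantDerivativeOnUniv.smul_const k
    ((hg.isSmoothField_leviCivita hX hZ).mdifferentiableAt x)
  have h3 := VectorField.mlieBracket_const_smul_left (W := Y) (c := k) (hX.mdifferentiableAt x)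
  rw [curvature, curvature, h1, h2, h3, Pi.smul_apply, map_smul, map_smul, _root_.smul_apply,
    smul_sub, smul_sub]

end WarpedNormal

/-! ### Normality and the Einstein condition. -/

section SliceNormal

variable {n : ℕ} {M : Type*} [TopologicalSpace M] [ChartedSpace (EuclideanSpace ℝ (Fin n)) M]
  [IsManifold (𝓡 n) ∞ M]
  {E' : Type*} [NormedAddCommGroup E'] [NormedSpace ℝ E']
  {H' : Type*} [TopologicalSpace H'] {J : ModelWithCorners ℝ E' H'}
  {N : Type*} [TopologicalSpace N] [ChartedSpace H' N] [IsManifold J 1 N]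
  {gN : Π y : N, TangentSpace J y →L[ℝ] TangentSpace J y →L[ℝ] ℝ} {φ : N → ℝ}
  {g : Π x : M, TangentSpace (𝓡 n) x →L[ℝ] TangentSpace (𝓡 n) x →L[ℝ] ℝ}

namespace IsLightlikeSlice

variable {b₀ : N} {b : E' →L[ℝ] E' →L[ℝ] ℝ} {dφ : E' →L[ℝ] ℝ} {ξ η G : E'}

/-- The coefficient `k` is the curvature of the trivial connection applied to `a`. Its value is
immaterial: what matters is that the base component stays in the line bundle. -/
theorem curvature_apply (S : IsLightlikeSlice gN φ g b₀ b dφ ξ η G) {a : M → ℝ}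
    {W X Y : Π x : M, TangentSpace (𝓡 n) x} (ha : ContMDiff (𝓡 n) 𝓘(ℝ, ℝ) ∞ a)
    (hW : IsSmoothField (𝓡 n) W) (hX : IsSmoothField (𝓡 n) X) (hY : IsSmoothField (𝓡 n) Y)
    (x : M) :
    ∃ k : ℝ, @Eq (E' × TangentSpace (𝓡 n) x)
      (curvature (sliceConnection gN φ g b₀) X Y (sliceSection b₀ (fun x ↦ a x • ξ) W) x)
      (k • ξ, curvature (leviCivita g) X Y W x
        - dφ G • (g x (Y x) (W x) • X x - g x (X x) (W x) • Y x)) := by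
  have := S.finiteDimensional
  have h1 (y : M) (v : TangentSpace (𝓡 n) y) :
      mvfderiv (𝓡 n) (fun z ↦ a z • ξ) y v = mvfderiv (𝓡 n) a y v • ξ :=
    mvfderiv_smul_vector ((ha y).mdifferentiableAt (by simp)) ξ v
  have h2 {Y : Π x : M, TangentSpace (𝓡 n) x} (hY : IsSmoothField (𝓡 n) Y)
      (v : TangentSpace (𝓡 n) x) :
      mvfderiv (𝓡 n) (fun y ↦ mvfderiv (𝓡 n) (fun z ↦ a z • ξ) y (Y y)) x v =
        mvfderiv (𝓡 n) (fun y ↦ mvfderiv (𝓡 n) a y (Y y)) x v • ξ := by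
    rw [funext fun y ↦ h1 y (Y y)]
    exact mvfderiv_smul_vector
      ((contMDiffAt_mvfderiv_apply (ha x) (hY x)).mdifferentiableAt (by simp)) ξ v
  have hu : ContMDiff (𝓡 n) 𝓘(ℝ, E') ∞ (fun x ↦ a x • ξ) := ha.smul contMDiff_const
  refine ⟨mvfderiv (𝓡 n) (fun y ↦ mvfderiv (𝓡 n) a y (Y y)) x (X x)
      - mvfderiv (𝓡 n) (fun y ↦ mvfderiv (𝓡 n) a y (X y)) x (Y x)
      - mvfderiv (𝓡 n) a x (VectorField.mlieBracket (𝓡 n) X Y x),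
    (curvature_pullbackConnection_sliceSection S.base S.fiber S.warping S.warping_eq
      S.mvfderiv_warping (by rw [S.base_eq]; exact S.gradient)
      hu hW hX hY x).trans (congrArg (fun p ↦ (p, _)) ?_)⟩
  rw [h1, h2 hX, h2 hY, ← sub_smul, ← sub_smul]

theorem curvature_mem_sliceLine (S : IsLightlikeSlice gN φ g b₀ b dφ ξ η G)
    {X Y : Π x : M, TangentSpace (𝓡 n) x}
    {σ : Π x, (sliceMap (𝓡 n) M J b₀ *ᵖ (TangentSpace (J.prod (𝓡 n)) : N × M → Type _)) x}
    (hX : IsSmoothField (𝓡 n) X) (hY : IsSmoothField (𝓡 n) Y)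
    (hσ : IsLineSection (n := n) (E' × EuclideanSpace ℝ (Fin n)) (sliceLine n M J b₀ ξ) σ)
    (x : M) : curvature (sliceConnection gN φ g b₀) X Y σ x ∈ sliceLine n M J b₀ ξ x := by
  obtain ⟨a, ha, rfl⟩ := S.exists_eq_of_isLineSection hσ
  obtain ⟨k, hk⟩ := S.curvature_apply ha isSmoothField_zero hX hY x
  refine mem_sliceLine_iff.2 ⟨k, hk.trans (congrArg (fun p ↦ (k • ξ, p)) ?_)⟩
  have h (v : TangentSpace (𝓡 n) x) :
      g x v ((0 : Π x : M, TangentSpace (𝓡 n) x) x) = 0 := map_zero (g x v)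
  rw [curvature_leviCivita_zero, h, h, zero_smul, zero_smul, sub_zero, smul_zero, sub_zero]
  rfl

/-- `Z` is the tangent part of `∇_Y σ`. The `ξ`-components on both sides of the metric drop out,
leaving the Ricci contraction of `g` applied to `Z` corrected by the constant curvature term. -/
theorem sum_metric_curvature (S : IsLightlikeSlice gN φ g b₀ b dφ ξ η G) {a : M → ℝ}
    (ha : ContMDiff (𝓡 n) 𝓘(ℝ, ℝ) ∞ a) {E : Fin n → Π x : M, TangentSpace (𝓡 n) x}
    {X Y Z : Π x : M, TangentSpace (𝓡 n) x} (hE : ∀ i, IsSmoothField (𝓡 n) (E i))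
    (hX : IsSmoothField (𝓡 n) X) (hY : IsSmoothField (𝓡 n) Y)
    (hZ : Z = fun x ↦ (a x * dφ ξ) • Y x) (x : M) :
    ∑ i, sliceMetric gN φ g b₀ x (curvature (sliceConnection gN φ g b₀) (E i) X
        (fun y ↦ sliceConnection gN φ g b₀ (sliceSection b₀ (fun x ↦ a x • ξ) 0) y (Y y)) x)
        (sliceConnection gN φ g b₀ (sliceSection b₀ (fun x ↦ a x • ξ) 0) x (E i x)) =
      a x * dφ ξ * (∑ i, g x (curvature (leviCivita g) (E i) X Z x) (E i x)
        - dφ G * (g x (X x) (Z x) * ∑ i, g x (E i x) (E i x)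
          - ∑ i, g x (E i x) (Z x) * g x (X x) (E i x))) := by
  have hda : ContMDiff (𝓡 n) 𝓘(ℝ, ℝ) ∞ (fun x ↦ mvfderiv (𝓡 n) a x (Y x)) :=
    fun x ↦ contMDiffAt_mvfderiv_apply (ha x) (hY x)
  have hZs : IsSmoothField (𝓡 n) Z := hZ ▸ IsSmoothField.smul (ha.mul contMDiff_const) hY
  rw [S.connection_line_field ha Y, ← hZ, Finset.mul_sum, ← Finset.sum_sub_distrib,
    Finset.mul_sum, ← Finset.sum_sub_distrib, Finset.mul_sum]
  refine Finset.sum_congr rfl fun i _ ↦ ?_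
  obtain ⟨k, hk⟩ := S.curvature_apply hda hZs (hE i) hX x
  refine (congrArg (fun p : E' × EuclideanSpace ℝ (Fin n) ↦ sliceMetric gN φ g b₀ x p _)
    hk).trans ((S.metric_connection_line ha x (E i x) k _).trans ?_)
  simp only [map_sub, map_smul, _root_.sub_apply, _root_.smul_apply, smul_eq_mul]

-- Source of the factor `n - 1`: the first sum is `n`, and the second is one copy of `g x v w` by
-- the expansion in the frame.
omit [IsManifold (𝓡 n) ∞ M] in
theorem sum_metric_sub {x : M}
    {e : Fin n → TangentSpace (𝓡 n) x} (he : ∀ i j, g x (e i) (e j) = if i = j then 1 else 0)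
    (v w : TangentSpace (𝓡 n) x) :
    g x v w * ∑ i, g x (e i) (e i) - ∑ i, g x (e i) w * g x v (e i) = (n - 1) * g x v w := by
  have h1 := sum_orthonormal (F := EuclideanSpace ℝ (Fin n)) finrank_euclideanSpace_fin
    (b := g x) he v w
  have h2 : ∑ i, g x (e i) (e i) = n := by simp [he]
  rw [h2]
  refine (congrArg (fun r : ℝ ↦ g x v w * n - r) h1).trans ?_
  have alg (a n : ℝ) : a * n - a = (n - 1) * a := by ring
  exact alg _ _

theorem isEinsteinWith_of_isNormalTractor (S : IsLightlikeSlice gN φ g b₀ b dφ ξ η G)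
    (h : IsNormalTractor (M := M) (sliceMetric gN φ g b₀) (sliceLine n M J b₀ ξ)
      (sliceConnection gN φ g b₀)) :
    IsEinsteinWith g ((n - 1) * dφ G) := by
  intro E X Y x hE hX hY hEE
  -- For the constant coefficient `(dφ ξ)⁻¹` the metric `h^σ` is `g`, and `β_σ(Y)` is represented by
  -- `Y` itself.
  have ha : ContMDiff (𝓡 n) 𝓘(ℝ, ℝ) ∞ (fun _ : M ↦ (dφ ξ)⁻¹) := contMDiff_const
  have hc : (dφ ξ)⁻¹ * dφ ξ = 1 := inv_mul_cancel₀ S.transverse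
  have hh (i j : Fin n) : sliceMetric gN φ g b₀ x
      (sliceConnection gN φ g b₀ (sliceSection b₀ (fun _ ↦ (dφ ξ)⁻¹ • ξ) 0) x (E i x))
      (sliceConnection gN φ g b₀ (sliceSection b₀ (fun _ ↦ (dφ ξ)⁻¹ • ξ) 0) x (E j x)) =
      if i = j then 1 else 0 := by
    refine (congrArg (fun p : E' × EuclideanSpace ℝ (Fin n) ↦ sliceMetric gN φ g b₀ x p _)
      (S.connection_line_apply ha x (E i x))).trans ?_
    refine (S.metric_connection_line ha x (E j x) _ _).trans ?_
    rw [hc, one_mul, one_smul]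
    exact hEE i j
  have h1 := h.ricci_eq_zero E X Y _ x hE hX hY (isLineSection _ ha) hh
  have h2 := (S.sum_metric_curvature (Z := Y) ha hE hX hY
    (by simp only [hc, one_smul]) x).symm.trans h1
  have h3 := sum_metric_sub hEE (X x) (Y x)
  rw [h3, hc, one_mul, sub_eq_zero] at h2
  rw [h2]
  ring

theorem isNormalTractor_of_isEinsteinWith (S : IsLightlikeSlice gN φ g b₀ b dφ ξ η G)
    (hn : n ≠ 0) (h : IsEinsteinWith g ((n - 1) * dφ G)) :
    IsNormalTractor (M := M) (sliceMetric gN φ g b₀) (sliceLine n M J b₀ ξ)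
      (sliceConnection gN φ g b₀) where
  curvature_mem _ _ _ hX hY hσ x := S.curvature_mem_sliceLine hX hY hσ x
  ricci_eq_zero E X Y σ x hE hX hY hσ hEE := by
    obtain ⟨a, ha, rfl⟩ := S.exists_eq_of_isLineSection hσ
    have hk (i j : Fin n) : (a x * dφ ξ) ^ 2 * g x (E i x) (E j x) = if i = j then 1 else 0 := by
      refine Eq.trans ?_ (hEE i j)
      refine Eq.symm ((congrArg (fun p : E' × EuclideanSpace ℝ (Fin n) ↦
        sliceMetric gN φ g b₀ x p _) (S.connection_line_apply ha x (E i x))).trans ?_)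
      refine (S.metric_connection_line ha x (E j x) _ _).trans ?_
      rw [map_smul, _root_.smul_apply, smul_eq_mul]
      ring
    refine (S.sum_metric_curvature ha hE hX hY rfl x).trans ?_
    set k : ℝ := a x * dφ ξ with hkdef
    set Z : Π x : M, TangentSpace (𝓡 n) x := fun x ↦ (a x * dφ ξ) • Y x with hZdef
    have hZ : IsSmoothField (𝓡 n) Z := IsSmoothField.smul (ha.mul contMDiff_const) hY
    -- A frame orthonormal for `h^σ = k² g` contains a vector of square one.
    have hk0 : k ≠ 0 := by
      intro h0
      have h1 := hk ⟨0, Nat.pos_of_ne_zero hn⟩ ⟨0, Nat.pos_of_ne_zero hn⟩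
      rw [h0, if_pos rfl] at h1
      norm_num at h1
    have hg2 (v w : TangentSpace (𝓡 n) x) : g x (k • v) (k • w) = k ^ 2 * g x v w := by
      rw [map_smul, map_smul, _root_.smul_apply, smul_eq_mul, smul_eq_mul]
      ring
    have hg3 (v w z : TangentSpace (𝓡 n) x) :
        g x (k • v) z * g x w (k • v) = k ^ 2 * (g x v z * g x w v) := by
      rw [map_smul, map_smul, _root_.smul_apply, smul_eq_mul, smul_eq_mul]
      ring
    have he (i j : Fin n) : g x (k • E i x) (k • E j x) = if i = j then 1 else 0 :=
      (hg2 _ _).trans (hk i j)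
    -- Multiplying the frame by the number `k`, the value at `x` only, makes it orthonormal for `g`
    -- at `x`. Both sums are quadratic in the frame and pick up `k²`, which is cancelled at the end.
    have h1 := h (fun i ↦ k • E i) X Z x
      (fun i ↦ IsSmoothField.smul (contMDiff_const (c := k)) (hE i)) hX hZ he
    have h2 : ∑ i, g x (curvature (leviCivita g) (k • E i) X Z x) ((k • E i) x) =
        k ^ 2 * ∑ i, g x (curvature (leviCivita g) (E i) X Z x) (E i x) := by
      rw [Finset.mul_sum]
      refine Finset.sum_congr rfl fun i _ ↦ ?_
      rw [curvature_leviCivita_const_smul S.fiber k (hE i) hZ]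
      exact hg2 _ _
    have h3 := sum_metric_sub he (X x) (Z x)
    have h4 : ∑ i, g x (k • E i x) (k • E i x) = k ^ 2 * ∑ i, g x (E i x) (E i x) := by
      rw [Finset.mul_sum]
      exact Finset.sum_congr rfl fun i _ ↦ hg2 _ _
    have h5 : ∑ i, g x (k • E i x) (Z x) * g x (X x) (k • E i x) =
        k ^ 2 * ∑ i, g x (E i x) (Z x) * g x (X x) (E i x) := by
      rw [Finset.mul_sum]
      exact Finset.sum_congr rfl fun i _ ↦ hg3 _ _ _
    rw [h2] at h1
    rw [h4, h5] at h3
    refine mul_eq_zero_of_right _ ((mul_eq_zero_iff_left (a := k ^ 2) (pow_ne_zero 2 hk0)).1 ?_)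
    rw [mul_sub, h1]
    linear_combination (-dφ G) * h3

/-! ### Second fundamental form and mean curvature of the slice. -/

theorem pullbackMetric_slice (S : IsLightlikeSlice gN φ g b₀ b dφ ξ η G) :
    pullbackMetric (𝓡 n) (J.prod (𝓡 n)) (sliceMap (𝓡 n) M J b₀) (warpedMetric gN φ g) = g := by
  funext x
  refine ContinuousLinearMap.ext fun v ↦ ContinuousLinearMap.ext fun w ↦ ?_
  refine (congrArg₂ (fun p q : E' × EuclideanSpace ℝ (Fin n) ↦ sliceMetric gN φ g b₀ x p q)
    (mfderiv_sliceMap b₀ x v) (mfderiv_sliceMap b₀ x w)).trans ?_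
  refine (S.metric_apply x (0, v) (0, w)).trans ?_
  have h : b (0 : E') 0 = 0 := map_zero _
  exact (congrArg (fun r : ℝ ↦ r + g x v w) h).trans (zero_add _)

/-- A field tangent to the slice has `u = 0`, so its derivative is `(-g(v, W) G, ∇^g_v W)`. The
induced metric is `g`, so the Gauss formula removes the second component: the slice is totally
umbilical. -/
theorem secondFundamentalForm_slice (S : IsLightlikeSlice gN φ g b₀ b dφ ξ η G) (x : M)
    (v w : TangentSpace (𝓡 n) x) :
    @Eq (E' × TangentSpace (𝓡 n) x) (secondFundamentalForm (sliceMap (𝓡 n) M J b₀)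
      (warpedMetric gN φ g) x v w) (-g x v w • G, 0) := by
  have := S.finiteDimensional
  set W : Π x : M, TangentSpace (𝓡 n) x := FiberBundle.extend (EuclideanSpace ℝ (Fin n)) w
  have hW : MDifferentiableAt (𝓡 n) ((𝓡 n).prod 𝓘(ℝ, EuclideanSpace ℝ (Fin n)))
      (fun y ↦ TotalSpace.mk' (EuclideanSpace ℝ (Fin n)) y (W y)) x :=
    FiberBundle.mdifferentiableAt_extend ..
  have h1 : (fun y ↦ differential (sliceMap (𝓡 n) M J b₀) y (W y)) =
      sliceSection b₀ (fun _ ↦ 0) W := funext fun y ↦ mfderiv_sliceMap b₀ y (W y)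
  have h2 := pullbackConnection_sliceSection S.base S.fiber S.warping S.warping_eq
    S.mvfderiv_warping (by rw [S.base_eq]; exact S.gradient) (u := fun _ ↦ (0 : E'))
    mdifferentiableAt_const hW v
  have h3 : leviCivita (pullbackMetric (𝓡 n) (J.prod (𝓡 n)) (sliceMap (𝓡 n) M J b₀)
      (warpedMetric gN φ g)) W x v = leviCivita g W x v := by rw [S.pullbackMetric_slice]
  have h4 := (mfderiv_sliceMap (J := J) (I := 𝓡 n) b₀ x (leviCivita (pullbackMetric (𝓡 n)
      (J.prod (𝓡 n)) (sliceMap (𝓡 n) M J b₀) (warpedMetric gN φ g)) W x v)).trans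
    (congrArg (fun p : EuclideanSpace ℝ (Fin n) ↦ ((0, p) : E' × EuclideanSpace ℝ (Fin n))) h3)
  have h5 : W x = w := FiberBundle.extend_apply_self ..
  have h6 : inducedConnection (sliceMap (𝓡 n) M J b₀) (warpedMetric gN φ g)
      (fun y ↦ differential (sliceMap (𝓡 n) M J b₀) y (W y)) x v = _ :=
    (congrArg (fun σ ↦ inducedConnection (sliceMap (𝓡 n) M J b₀) (warpedMetric gN φ g) σ x v)
      h1).trans h2
  refine (congrArg₂ (fun p q : E' × EuclideanSpace ℝ (Fin n) ↦ p - q) h6 h4).trans ?_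
  refine Prod.ext ?_ ?_
  · change mvfderiv (𝓡 n) (fun _ : M ↦ (0 : E')) x v - g x v (W x) • G - 0 = -g x v w • G
    rw [mvfderiv_const, h5, sub_zero, neg_smul]
    exact zero_sub _
  · change leviCivita g W x v + dφ 0 • v - leviCivita g W x v = 0
    rw [map_zero, zero_smul, add_zero, sub_self]

theorem meanCurvature_slice (S : IsLightlikeSlice gN φ g b₀ b dφ ξ η G) (hn : n ≠ 0) (x : M) :
    @Eq (E' × TangentSpace (𝓡 n) x) (meanCurvature (sliceMap (𝓡 n) M J b₀)
      (warpedMetric gN φ g) x) (-G, 0) := by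
  have h1 (i : Fin n) : @Eq (E' × EuclideanSpace ℝ (Fin n))
      (secondFundamentalForm (sliceMap (𝓡 n) M J b₀)
      (warpedMetric gN φ g) x (EuclideanSpace.single i (1 : ℝ))
      ((pullbackMetric (𝓡 n) (J.prod (𝓡 n)) (sliceMap (𝓡 n) M J b₀) (warpedMetric gN φ g) x).inverse
      (EuclideanSpace.proj i : EuclideanSpace ℝ (Fin n) →L[ℝ] ℝ))) (-G, 0) := by
    refine (S.secondFundamentalForm_slice x _ _).trans ?_
    rw [S.pullbackMetric_slice]
    obtain ⟨e, he⟩ := S.fiber.isInvertible x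
    -- Pairing a basis vector with the metric dual of its own coordinate covector gives one, so
    -- every term of the trace equals `-G`.
    have h : g x (EuclideanSpace.single i (1 : ℝ)) ((g x).inverse
      (EuclideanSpace.proj i : EuclideanSpace ℝ (Fin n) →L[ℝ] ℝ)) = 1 := by
      refine (S.fiber.symm x _ _).trans ?_
      rw [← he, ContinuousLinearMap.inverse_equiv]
      refine (congrArg (fun L : EuclideanSpace ℝ (Fin n) →L[ℝ] ℝ ↦
        L (EuclideanSpace.single i (1 : ℝ))) (e.apply_symm_apply _)).trans ?_
      simp
    exact congrArg (fun p : E' ↦ (p, (0 : EuclideanSpace ℝ (Fin n))))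
      ((congrArg (fun r : ℝ ↦ -r • G) h).trans (neg_one_smul ℝ G))
  have h2 : @Eq (E' × EuclideanSpace ℝ (Fin n)) (meanCurvature (sliceMap (𝓡 n) M J b₀)
      (warpedMetric gN φ g) x) ((1 / n : ℝ) • ∑ _i : Fin n, (-G, 0)) :=
    congrArg (fun p : E' × EuclideanSpace ℝ (Fin n) ↦ (1 / n : ℝ) • p)
      (Finset.sum_congr rfl fun i _ ↦ h1 i)
  refine h2.trans ?_
  have hn' : (n : ℝ) ≠ 0 := Nat.cast_ne_zero.2 hn
  rw [Finset.sum_const, Finset.card_univ, Fintype.card_fin, ← Nat.cast_smul_eq_nsmul ℝ, smul_smul,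
    one_div, inv_mul_cancel₀ hn', one_smul]
  rfl

theorem metric_meanCurvature_slice (S : IsLightlikeSlice gN φ g b₀ b dφ ξ η G) (hn : n ≠ 0)
    (x : M) : sliceMetric gN φ g b₀ x
      (meanCurvature (sliceMap (𝓡 n) M J b₀) (warpedMetric gN φ g) x)
      (meanCurvature (sliceMap (𝓡 n) M J b₀) (warpedMetric gN φ g) x) = dφ G := by
  refine (congrArg₂ (fun p q : E' × EuclideanSpace ℝ (Fin n) ↦ sliceMetric gN φ g b₀ x p q)
    (S.meanCurvature_slice hn x) (S.meanCurvature_slice hn x)).trans ?_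
  refine (S.metric_apply x (-G, 0) (-G, 0)).trans ?_
  have h0 (v : TangentSpace (𝓡 n) x) : g x v (0 : TangentSpace (𝓡 n) x) = 0 := map_zero _
  refine (congrArg (fun r : ℝ ↦ b (-G) (-G) + r) (h0 _)).trans ?_
  rw [add_zero, map_neg, map_neg, _root_.neg_apply, neg_neg, S.gradient]

end IsLightlikeSlice

end SliceNormal

end

/-! ### The theorem. -/

theorem mainTheorem4 {n : ℕ} (hn : 2 ≤ n)
    {M : Type*} [TopologicalSpace M] [T2Space M] [ChartedSpace (EuclideanSpace ℝ (Fin n)) M]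
    [IsManifold (𝓡 n) ∞ M]
    (g : ContMDiffRiemannianMetric (𝓡 n) ∞ (EuclideanSpace ℝ (Fin n))
      (TangentSpace (𝓡 n) : M → Type _))
    (B : TopologicalSpace.Opens (EuclideanSpace ℝ (Fin 2)))
    (gB : LorentzMetric (𝓡 2) B)
    (ξ η : Π b : B, TangentSpace (𝓡 2) b)
    (hξ : IsSmoothField (𝓡 2) ξ) (hη : IsSmoothField (𝓡 2) η)
    (hξξ : ∀ b, gB.inner b (ξ b) (ξ b) = 0) (hηη : ∀ b, gB.inner b (η b) (η b) = 0)
    (hξη : ∀ b, gB.inner b (ξ b) (η b) = -1)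
    (φ : B → ℝ) (hφ : ContMDiff (𝓡 2) 𝓘(ℝ, ℝ) ∞ φ) (hφpos : ∀ b, 0 < φ b)
    (b₀ : B) (hφb₀ : φ b₀ = 1) (hξφ : mvfderiv (𝓡 2) φ b₀ (ξ b₀) ≠ 0) :
    IsStandardTractor g.inner
      (bundleMetric (sliceMap (𝓡 n) M (𝓡 2) b₀) (warpedMetric gB.inner φ g.inner))
      (fun x ↦ Submodule.span ℝ {sliceLift (𝓡 n) M (𝓡 2) b₀ (ξ b₀) x})
      (inducedConnection (sliceMap (𝓡 n) M (𝓡 2) b₀) (warpedMetric gB.inner φ g.inner)) ∧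
    (IsNormalTractor
        (bundleMetric (sliceMap (𝓡 n) M (𝓡 2) b₀) (warpedMetric gB.inner φ g.inner))
        (fun x ↦ Submodule.span ℝ {sliceLift (𝓡 n) M (𝓡 2) b₀ (ξ b₀) x})
        (inducedConnection (sliceMap (𝓡 n) M (𝓡 2) b₀) (warpedMetric gB.inner φ g.inner)) ↔
      ∃ Λ : ℝ, IsEinsteinWith g.inner Λ ∧
        (∀ x : M, Λ = (n - 1) *
          bundleMetric (sliceMap (𝓡 n) M (𝓡 2) b₀) (warpedMetric gB.inner φ g.inner) x
            (meanCurvature (sliceMap (𝓡 n) M (𝓡 2) b₀) (warpedMetric gB.inner φ g.inner) x)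
            (meanCurvature (sliceMap (𝓡 n) M (𝓡 2) b₀) (warpedMetric gB.inner φ g.inner) x)) ∧
        Λ = (n - 1) *
          gB.inner b₀ (metricGradient gB.inner φ b₀) (metricGradient gB.inner φ b₀)) := by
  have hbase : IsSmoothMetric gB.inner :=
    ⟨gB.contMDiff, fun b ↦ (gB.lorentz b).symm, fun b ↦ (gB.lorentz b).nondegenerate⟩
  have hfiber : IsSmoothMetric g.inner := by
    refine ⟨g.contMDiff, g.symm, fun x v hv ↦ ?_⟩
    by_contra h
    exact (g.pos x v h).ne' (hv v)
  -- Nondegeneracy of the base metric makes the `inverse` in `metricGradient` a true inverse;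
  -- evaluated at the gradient, this identifies `dφ(G)` with its square.
  have hG (z : EuclideanSpace ℝ (Fin 2)) :
      gB.inner b₀ (metricGradient gB.inner φ b₀) z = mvfderiv (𝓡 2) φ b₀ z := by
    obtain ⟨e, he⟩ := hbase.isInvertible b₀
    rw [metricGradient, ← he, ContinuousLinearMap.inverse_equiv]
    exact congrArg (fun L : EuclideanSpace ℝ (Fin 2) →L[ℝ] ℝ ↦ L z) (e.apply_symm_apply _)
  have S : IsLightlikeSlice gB.inner φ g.inner b₀ (metricCoord gB.inner b₀ b₀)
      (mvfderiv (𝓡 2) φ b₀) (ξ b₀) (η b₀) (metricGradient gB.inner φ b₀) :=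
    { base := hbase
      fiber := hfiber
      fiber_pos := g.pos
      base_eq := rfl
      lorentz := by rw [metricCoord_self]; exact gB.lorentz b₀
      finrank_base := finrank_euclideanSpace_fin
      warping := (hφ b₀).mdifferentiableAt (by simp)
      warping_eq := hφb₀
      mvfderiv_warping := rfl
      gradient := by rw [metricCoord_self]; exact hG
      left_self := by rw [metricCoord_self]; exact hξξ b₀
      right_self := by rw [metricCoord_self]; exact hηη b₀
      left_right := by rw [metricCoord_self]; exact hξη b₀
      transverse := hξφ }
  have hn0 : n ≠ 0 := by omega
  have hN := hG (metricGradient gB.inner φ b₀)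
  refine ⟨S.isStandardTractor, fun h ↦ ?_, ?_⟩
  · exact ⟨_, S.isEinsteinWith_of_isNormalTractor h,
      fun x ↦ congrArg (fun r : ℝ ↦ (n - 1) * r) (S.metric_meanCurvature_slice hn0 x).symm,
      congrArg (fun r : ℝ ↦ (n - 1) * r) hN.symm⟩
  · rintro ⟨Λ, hΛ, -, rfl⟩
    refine S.isNormalTractor_of_isEinsteinWith hn0 ?_
    have h := congrArg (fun r : ℝ ↦ ((n : ℝ) - 1) * r) hN
    exact h ▸ hΛ
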